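/- Let $\mathbb F_q$ be a finite field, let $t,m_1,\dots,m_t,n_1,\dots,n_t$ be positive integers with $m_1\ge\cdots\ge m_t$ and $m_i\ge n_i$ for all $i$, and put $n=n_1+\cdots+n_t$ and $\mathbb M=\mathbb F_q^{m_1\times n_1}\times\cdots\times\mathbb F_q^{m_t\times n_t}$. A code is an $\mathbb F_q$-linear subspace of $\mathbb M$. For $C=(C_1,\dots,C_t)\in\mathbb M$ let $\mathrm{srk}(C)=\sum_i\mathrm{rk}(C_i)$. For a code $\mathcal C$ let $\mathrm{maxsrk}(\mathcal C)=\max_{C\in\mathcal C}\mathrm{srk}(C)$ and, if $\mathcal C\ne0$, $d(\mathcal C)=\min_{0\ne C\in\mathcal C}\mathrm{srk}(C)$. A subspace $\mathcal A\subseteq\mathbb F_q^{m_i\times n_i}$ is an optimal anticode if $\dim\mathcal A=m_i\max_{A\in\mathcal A}\mathrm{rk}(A)$. The weight $\mathrm{wt}(\mathcal C)$ of a code is the minimum of $\mathrm{maxsrk}(\mathcal A)$ over all $\mathcal A=\mathcal A_1\times\cdots\times\mathcal A_t\supseteq\mathcal C$ where each $\mathcal A_i\subseteq\mathbb F_q^{m_i\times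 n_i}$ is an optimal anticode. For $1\le r\le\dim\mathcal C$, the $r$-th generalized (sum-rank) weight is $d_r(\mathcal C)=\min\{\mathrm{wt}(\mathcal U):\mathcal U\subseteq\mathcal C,\ \dim\mathcal U\ge r\}$; the sequence of generalized weights of $\mathcal C$ is $d_1(\mathcal C),\dots,d_{\dim\mathcal C}(\mathcal C)$. The code $\mathcal C$ satisfies the chain condition if there are codes $0\subsetneq\mathcal U_1\subsetneq\cdots\subsetneq\mathcal U_{k}=\mathcal C$, $k=\dim\mathcal C$, with $\mathrm{wt}(\mathcal U_r)=d_r(\mathcal C)$ for $1\le r\le k$. A greedy $1$-subcode of $\mathcal C$ is a $1$-dimensional $\mathcal U\subseteq\mathcal C$ with $\mathrm{wt}(\mathcal U)=d_1(\mathcal C)$; for $2\le r\le\dim\mathcal C$ a greedy $r$-subcode is an $r$-dimensional subcode of minimum weight among those that contain a greedy $(r-1)$-subcode; the $r$-th greedy weight of $\mathcal C$ is the weight of any greedy $r$-subcode. The code $\mathcal C$ is MSRD if there are $j\in\{1,\dots,t\}$ and $0\le\delta\le n_j-1$ with $d(\mathcal C)=\sum_{i=1}^{j-1}n_i+\delta+1$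 and $\dim\mathcal C=\sum_{i=j}^t m_in_i-\delta m_j$. **Theorem.** Let $\mathcal D\subseteq\mathbb M$ be an MSRD code of minimum distance $d$ and assume that there is a chain of MSRD codes $\mathcal D=\mathcal D_d\supseteq\mathcal D_{d+1}\supseteq\cdots\supseteq\mathcal D_n$ with $d(\mathcal D_h)=h$ for $d\le h\le n$. A sequence of positive integers $d_1,\dots,d_k$ is the sequence of generalized weights of a code $\mathcal C\subseteq\mathcal D$ if and only if $k\le\dim\mathcal D$ and $d_1,\dots,d_k$ is a subsequence of the sequence of generalized weights of $\mathcal D$. Moreover, in that case $\mathcal C$ may be chosen such that it satisfies the chain condition and such that $d_1,\dots,d_k$ is also its sequence of greedy weights. In particular, every subsequence of the sequence of generalized weights of $\mathcal D$ is the sequence of greedy weights of a subcode of $\mathcal D$. -/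

import Mathlib

namespace SumRank

/-- The space `𝕄 = F^{m₁ × n₁} × ⋯ × F^{m_t × n_t}`. -/
abbrev Ambient (F : Type*) {t : ℕ} (m n : Fin t → ℕ) : Type _ :=
  ∀ i : Fin t, Matrix (Fin (m i)) (Fin (n i)) F

/-- A sum-rank metric code is an `F`-linear subspace of `𝕄`. -/
abbrev Code (F : Type*) [Field F] {t : ℕ} (m n : Fin t → ℕ) : Type _ :=
  Submodule F (Ambient F m n)

section

variable {F : Type*} [Field F] {t : ℕ} {m n : Fin t → ℕ}

/-- The sum-rank weight of an element of `𝕄`. -/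
noncomputable def srk (X : Ambient F m n) : ℕ := ∑ i, (X i).rank

/-- The minimum distance of a nonzero code (it is `0` for the zero code). -/
noncomputable def minDist (C : Code F m n) : ℕ :=
  sInf {w | ∃ X ∈ C, X ≠ 0 ∧ srk X = w}

/-- The maximum sum-rank distance of a code; sum-ranks are at most `∑ i, n i`, so this supremum
in `ℕ` is a maximum. -/
noncomputable def maxSrk (C : Code F m n) : ℕ :=
  sSup {w | ∃ X ∈ C, srk X = w}

/-- The maximum rank of an element of a space of `a × b` matrices. -/
noncomputable def maxRank {a b : ℕ} (A : Submodule F (Matrix (Fin a) (Fin b) F)) : ℕ :=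
  sSup {w | ∃ X ∈ A, X.rank = w}

/-- Optimal anticodes in `F^{a × b}` (where `b ≤ a`): the spaces of matrices that attain the
bound `dim A ≤ a · maxrk A`. -/
def IsOptimalAnticode {a b : ℕ} (A : Submodule F (Matrix (Fin a) (Fin b) F)) : Prop :=
  Module.finrank F A = a * maxRank A

/-- The weight of a code: the least maximum sum-rank of a product of optimal anticodes which
contains it. -/
noncomputable def wt (C : Code F m n) : ℕ :=
  sInf {w | ∃ A : ∀ i : Fin t, Submodule F (Matrix (Fin (m i)) (Fin (n i)) F),
    (∀ i, IsOptimalAnticode (A i)) ∧ C ≤ Submodule.pi Set.univ A ∧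
      maxSrk (m := m) (n := n) (Submodule.pi Set.univ A) = w}

/-- The `r`-th generalized sum-rank weight of `C`, for `1 ≤ r ≤ dim C`. -/
noncomputable def genWeight (C : Code F m n) (r : ℕ) : ℕ :=
  sInf {w | ∃ U : Code F m n, U ≤ C ∧ r ≤ Module.finrank F U ∧ wt U = w}

/-- The sequence `d₁(C), …, d_k(C)` of generalized weights of `C`, where `k = dim C`. -/
noncomputable def genWeights (C : Code F m n) : List ℕ :=
  List.ofFn fun r : Fin (Module.finrank F C) => genWeight C (r + 1)

/-- `C` is maximum sum-rank distance: for some `j` and some `0 ≤ δ ≤ n_j - 1`,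
`d(C) = ∑_{i < j} n_i + δ + 1` and `dim C = ∑_{i ≥ j} m_i n_i - δ m_j`. -/
def IsMSRD (C : Code F m n) : Prop :=
  ∃ (j : Fin t) (δ : ℕ), δ < n j ∧
    minDist C = (∑ i ∈ Finset.Iio j, n i) + δ + 1 ∧
    Module.finrank F C + δ * m j = ∑ i ∈ Finset.Ici j, m i * n i

/-- `IsGreedySubcode C r U` : `U` is a greedy `r`-subcode of `C` (`r ≥ 1`). -/
def IsGreedySubcode (C : Code F m n) : ℕ → Code F m n → Prop
  | 0, _ => False
  | 1, U => U ≤ C ∧ Module.finrank F U = 1 ∧ wt U = genWeight C 1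
  | r + 2, U =>
    (U ≤ C ∧ Module.finrank F U = r + 2 ∧ ∃ V ≤ U, IsGreedySubcode C (r + 1) V) ∧
    ∀ U' : Code F m n,
      (U' ≤ C ∧ Module.finrank F U' = r + 2 ∧ ∃ V ≤ U', IsGreedySubcode C (r + 1) V) →
        wt U ≤ wt U'

/-- All greedy `r`-subcodes of `C` have the same weight. -/
theorem IsGreedySubcode.wt_eq {C : Code F m n} {r : ℕ} {U V : Code F m n}
    (hU : IsGreedySubcode C r U) (hV : IsGreedySubcode C r V) : wt U = wt V := by
  match r with
  | 0 => exact absurd hU (by simp [IsGreedySubcode])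
  | 1 =>
    simp only [IsGreedySubcode] at hU hV
    rw [hU.2.2, hV.2.2]
  | r + 2 =>
    simp only [IsGreedySubcode] at hU hV
    exact le_antisymm (hU.2 V hV.1) (hV.2 U hU.1)

/-- The `r`-th greedy weight of `C`, for `1 ≤ r ≤ dim C`: the common weight of its greedy
`r`-subcodes. -/
noncomputable def greedyWeight (C : Code F m n) (r : ℕ) : ℕ :=
  sInf {w | ∃ U : Code F m n, IsGreedySubcode C r U ∧ wt U = w}

theorem IsGreedySubcode.wt_eq_greedyWeight {C : Code F m n} {r : ℕ} {U : Code F m n}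
    (hU : IsGreedySubcode C r U) : wt U = greedyWeight C r := by
  have h : {w | ∃ V : Code F m n, IsGreedySubcode C r V ∧ wt V = w} = {wt U} := by
    ext w
    constructor
    · rintro ⟨V, hV, rfl⟩
      exact hV.wt_eq hU
    · rintro rfl
      exact ⟨U, hU, rfl⟩
  rw [greedyWeight, h, csInf_singleton]

/-- The sequence `g₁(C), …, g_k(C)` of greedy weights of `C`, where `k = dim C`. -/
noncomputable def greedyWeights (C : Code F m n) : List ℕ :=
  List.ofFn fun r : Fin (Module.finrank F C) => greedyWeight C (r + 1)

/-- The chain condition: there are `0 = U₀ ⊊ U₁ ⊊ ⋯ ⊊ U_k = C`, `k = dim C`, such that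
`d_r(C) = wt(U_r)` for `1 ≤ r ≤ k`. (The zero code satisfies it trivially.) -/
def ChainCondition (C : Code F m n) : Prop :=
  ∃ U : ℕ → Code F m n, U 0 = ⊥ ∧ U (Module.finrank F C) = C ∧
    (∀ r < Module.finrank F C, U r < U (r + 1)) ∧
    ∀ r, 1 ≤ r → r ≤ Module.finrank F C → genWeight C r = wt (U r)

end

end SumRank

/-! Generalized weights increase weakly, so such a sequence is determined by its multiplicities, and
one is a subsequence of another exactly when no value occurs more often in it. Number the columns of
all blocks consecutively and let column `w` lie in block `j`. Two facts then suffice.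

No code has more than `m j` generalized weights equal to `w` (`count_genWeights_le`). Indeed, a
product of optimal anticodes of total maximum rank `w` does not fit into the blocks before `j`, so
it has positive maximum rank in some block `i ≥ j`. There `m i ≤ m j` linear equations cut out an
optimal anticode whose maximum rank is smaller by one, and a subcode loses at most `m j` dimensions
when its weight drops below `w`.

The code `D` has exactly `m j` generalized weights equal to `w` for each `w` from `d` to the number
of columns, and it has a basis that shows this (`IsMaximalChain.exists_isAdapted`). By dimension,
the chain code of distance `w` contains `m j` independent elements supported on the first `w`
columns; by rank, their span meets the next chain code trivially. In the span of any subfamily of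
this basis, an initial segment has small weight because of its column support. A subcode of
dimension `r` meets the span of the `r`-th and later vectors, which lies in a chain code, so its
weight is large. Initial segments therefore realize the generalized weights, which yields the chain
condition and the greedy weights as well.

The cutting step rests on the structure of optimal anticodes (`exists_linearMap_rank_lt`). Leading
positions of matrices turn the dimension bound into a covering of a bipartite graph by rows and
columns. Equality forces either a common row space of dimension `r`, or, for square matrices, that
all rows are fixed combinations of `r` of them. -/

namespace SumRank

/-! ### Exchange arguments for independent families -/

section LinearIndependence

variable {F : Type*} [Field F] {E : Type*} [AddCommGroup E] [Module F E]

theorem linearIndependent_update_of_notMem {ι : Type*} [Fintype ι] [DecidableEq ι] {y : ι → E}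
    (hy : LinearIndependent F y) (p : ι) {x : E} (hx : x ∉ Submodule.span F (y '' {p}ᶜ)) :
    LinearIndependent F (Function.update y p x) := by
  rw [Fintype.linearIndependent_iff] at hy ⊢
  intro c hc
  rw [Fintype.sum_eq_add_sum_compl p] at hc
  have hrest : ∑ i ∈ {p}ᶜ, c i • Function.update y p x i = ∑ i ∈ {p}ᶜ, c i • y i := by
    refine Finset.sum_congr rfl fun i hi => ?_
    rw [Function.update_of_ne (by simpa using hi)]
  rw [hrest, Function.update_self] at hc
  have hmem : ∑ i ∈ ({p}ᶜ : Finset ι), c i • y i ∈ Submodule.span F (y '' {p}ᶜ) :=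
    Submodule.sum_mem _ fun i hi => Submodule.smul_mem _ _
      (Submodule.subset_span ⟨i, by simpa using hi, rfl⟩)
  have hp : c p = 0 := by
    by_contra hcp
    apply hx
    have : c p • x ∈ Submodule.span F (y '' {p}ᶜ) := by
      rw [eq_neg_of_add_eq_zero_left hc]
      exact Submodule.neg_mem _ hmem
    exact (Submodule.smul_mem_iff _ hcp).1 this
  refine hy c ?_
  rw [Fintype.sum_eq_add_sum_compl p, hp, zero_smul]
  rwa [hp, zero_smul] at hc

/-- If `u` lies in the span of the other vectors, then `u + y p` does not. Only the coefficients 0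
and 1 are used, so the size of the field plays no role. -/
theorem linearIndependent_update_or {ι : Type*} [Fintype ι] [DecidableEq ι] {y : ι → E}
    (hy : LinearIndependent F y) (p : ι) (u : E) :
    LinearIndependent F (Function.update y p u) ∨
      LinearIndependent F (Function.update y p (u + y p)) := by
  by_cases hu : u ∈ Submodule.span F (y '' {p}ᶜ)
  · right
    refine linearIndependent_update_of_notMem hy p fun h => ?_
    have := (Submodule.add_mem_iff_right _ hu).1 h
    exact hy.notMem_span_image (s := {p}ᶜ) (x := p) (by simp) this
  · exact Or.inl (linearIndependent_update_of_notMem hy p hu)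

/-- Vectors whose first nonzero entries are in distinct positions are independent. -/
theorem linearIndependent_of_leading {ι : Type*} [Finite ι] {b : ℕ} (v : ι → Fin b → F)
    (h : ι → Fin b) (hinj : Function.Injective h) (hne : ∀ i, v i (h i) ≠ 0)
    (hlt : ∀ i, ∀ j < h i, v i j = 0) : LinearIndependent F v := by
  classical
  cases nonempty_fintype ι
  rw [Fintype.linearIndependent_iff]
  intro c hc
  by_contra! hcon
  obtain ⟨i₀, hi₀⟩ := hcon
  -- At the leftmost leading position among the vectors with nonzero coefficient, all other terms
  -- vanish.
  obtain ⟨i, hi, hmin⟩ := Finset.exists_min_image (Finset.univ.filter fun i => c i ≠ 0) h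
    ⟨i₀, by simpa using hi₀⟩
  have hci : c i ≠ 0 := by simpa using hi
  have := congrFun hc (h i)
  rw [Finset.sum_apply, Finset.sum_eq_single i] at this
  · simp only [Pi.smul_apply, smul_eq_mul, Pi.zero_apply, mul_eq_zero] at this
    exact this.elim hci (hne i)
  · intro k _ hki
    by_cases hck : c k = 0
    · simp [hck]
    · have hle := hmin k (by simpa using hck)
      have hlt' : h i < h k := lt_of_le_of_ne hle fun e => hki (hinj e).symm
      simp [hlt k _ hlt']
  · simp

/-- Steinitz exchange: `z` replaces a vector with nonzero coefficient in its expansion, or any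
vector if `z` is outside the span; a transposition then moves it to position `l`. -/
theorem exists_linearIndependent_apply_eq [FiniteDimensional F E] {ι : Type*} [Fintype ι]
    [DecidableEq ι] (hcard : Fintype.card ι ≤ Module.finrank F E) (l : ι) {z : E} (hz : z ≠ 0) :
    ∃ y : ι → E, LinearIndependent F y ∧ y l = z := by
  obtain ⟨y, hy⟩ : ∃ y : ι → E, LinearIndependent F y := by
    have e : ι ↪ Fin (Module.finrank F E) :=
      (Fintype.equivFin ι).toEmbedding.trans (Fin.castLEEmb hcard)
    exact ⟨Module.finBasis F E ∘ e, (Module.finBasis F E).linearIndependent.comp e e.injective⟩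
  obtain ⟨k, hk⟩ : ∃ k, z ∉ Submodule.span F (y '' {k}ᶜ) := by
    by_cases hzy : z ∈ Submodule.span F (Set.range y)
    · obtain ⟨c, rfl⟩ := (Submodule.mem_span_range_iff_exists_fun F).1 hzy
      obtain ⟨k, -, hk⟩ := Finset.exists_ne_zero_of_sum_ne_zero hz
      refine ⟨k, fun hmem => ?_⟩
      rw [Fintype.sum_eq_add_sum_compl k] at hmem
      have hrest : ∑ i ∈ ({k}ᶜ : Finset ι), c i • y i ∈ Submodule.span F (y '' {k}ᶜ) :=
        Submodule.sum_mem _ fun i hi => Submodule.smul_mem _ _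
          (Submodule.subset_span ⟨i, by simpa using hi, rfl⟩)
      have h := (Submodule.add_mem_iff_left _ hrest).1 hmem
      have hck : c k ≠ 0 := fun h0 => hk (by rw [h0, zero_smul])
      exact hy.notMem_span_image (s := {k}ᶜ) (x := k) (by simp)
        ((Submodule.smul_mem_iff _ hck).1 h)
    · exact ⟨l, fun h => hzy (Submodule.span_mono (Set.image_subset_range _ _) h)⟩
  refine ⟨Function.update y k z ∘ Equiv.swap k l,
    (linearIndependent_update_of_notMem hy k hk).comp _ (Equiv.injective _), ?_⟩
  simp

/-- If a linear map sends each independent tuple of fewer than `dim E` vectors into the span of that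
tuple, then it is a fixed linear combination of the entries. -/
theorem exists_forall_eq_sum_smul_of_mem_span [FiniteDimensional F E] {ι : Type*} [Fintype ι]
    [DecidableEq ι] (hcard : Fintype.card ι < Module.finrank F E) (L : (ι → E) →ₗ[F] E)
    (hL : ∀ y : ι → E, LinearIndependent F y → L y ∈ Submodule.span F (Set.range y)) :
    ∃ c : ι → F, ∀ y, L y = ∑ i, c i • y i := by
  -- Otherwise some functional `φ` kills `z` but not `L (Pi.single l z)`. Its kernel still has room
  -- for an independent tuple with entry `z` at some `l' ≠ l`. Adding `z` to the entry at `l` keeps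
  -- the tuple independent, and `L` maps both tuples into the kernel, hence also their difference
  -- `Pi.single l z`. A single index needs a separate, direct argument.
  have hmem : ∀ l (z : E), L (Pi.single l z) ∈ Submodule.span F {z} := by
    intro l z
    by_contra hz
    have hz0 : z ≠ 0 := by
      rintro rfl
      simp at hz
    by_cases hl : ∃ l', l' ≠ l
    · obtain ⟨l', hl'⟩ := hl
      obtain ⟨φ, hφ, hφz⟩ := Submodule.exists_dual_map_eq_bot_of_notMem hz inferInstance
      have hφz : φ z = 0 := by
        have : φ z ∈ (Submodule.span F {z}).map φ :=
          Submodule.mem_map_of_mem (Submodule.mem_span_singleton_self z)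
        rw [hφz] at this
        simpa using this
      have hφ0 : φ ≠ 0 := by
        rintro rfl
        simp at hφ
      have hdim := Module.Dual.finrank_ker_add_one_of_ne_zero hφ0
      obtain ⟨y, hy, hyl⟩ := exists_linearIndependent_apply_eq (F := F) (E := LinearMap.ker φ)
        (by omega : Fintype.card ι ≤ _) l' (z := ⟨z, hφz⟩) (fun h => hz0 (congrArg Subtype.val h))
      have key : ∀ w : ι → LinearMap.ker φ, LinearIndependent F w →
          φ (L fun i => (w i : E)) = 0 := by
        intro w hw
        have hspan := hL (fun i => (w i : E))
          (hw.map' (LinearMap.ker φ).subtype (Submodule.ker_subtype _))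
        have hle : Submodule.span F (Set.range fun i => (w i : E)) ≤ LinearMap.ker φ := by
          rw [Submodule.span_le]
          rintro _ ⟨i, rfl⟩
          exact (w i).2
        exact hle hspan
      have h1 := key y hy
      have h2 : φ (L fun i => (Function.update y l (y l + y l') i : E)) = 0 := by
        apply key
        refine linearIndependent_update_of_notMem hy l fun h => ?_
        have hmem : y l' ∈ Submodule.span F (y '' {l}ᶜ) :=
          Submodule.subset_span ⟨l', hl', rfl⟩
        exact hy.notMem_span_image (s := {l}ᶜ) (x := l) (by simp)
          ((Submodule.add_mem_iff_left _ hmem).1 h)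
      have hsum : (fun i => (Function.update y l (y l + y l') i : E)) =
          (fun i => (y i : E)) + Pi.single l z := by
        funext i
        by_cases hi : i = l
        · subst hi
          simp [hyl]
        · simp [hi]
      rw [hsum, map_add, map_add, h1, zero_add] at h2
      exact hφ h2
    · push Not at hl
      have : Unique ι := ⟨⟨l⟩, hl⟩
      have hli : LinearIndependent F (fun _ : ι => z) := by
        rw [linearIndependent_unique_iff]
        exact hz0
      have hsingle : (fun _ : ι => z) = Pi.single l z := by
        funext i
        rw [hl i, Pi.single_eq_same]
      have := hL _ hli
      rw [hsingle] at this
      refine hz (Submodule.span_mono ?_ this)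
      rintro _ ⟨i, rfl⟩
      rw [hl i, Pi.single_eq_same]
      exact Set.mem_singleton z
  -- An endomorphism that maps every vector to a multiple of itself is a scalar.
  have hscal : ∀ l, ∃ c : F, ∀ z, L (Pi.single l z) = c • z := by
    intro l
    obtain ⟨c, hc⟩ := LinearMap.exists_eq_smul_id_of_forall_notLinearIndependent (R := F) (V := E)
      (f := L ∘ₗ LinearMap.single F (fun _ => E) l) fun v h => by
        obtain ⟨c, hc⟩ := Submodule.mem_span_singleton.1 (hmem l v)
        rw [LinearIndependent.pair_iff] at h
        have := h c (-1) (by simp [hc])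
        simp at this
    exact ⟨c, fun z => by simpa using LinearMap.congr_fun hc z⟩
  choose c hc using hscal
  refine ⟨c, fun y => ?_⟩
  conv_lhs => rw [← Finset.univ_sum_single y]
  rw [map_sum]
  exact Finset.sum_congr rfl fun i _ => hc i _

end LinearIndependence

/-! ### König's theorem, deduced from Hall's -/

section Koenig

/-- If every partial transversal of `P` has at most `r` elements, there is a set `S` of indices such
that the rows outside `S` and the columns met by the rows in `S` are at most `r` in number. -/
theorem exists_card_biUnion_add_card_compl_le {a b r : ℕ} (P : Fin a → Finset (Fin b))
    (hP : ∀ (S : Finset (Fin a)) (h : S → Fin b), Function.Injective h → (∀ i : S, h i ∈ P i) →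
      S.card ≤ r) :
    ∃ S : Finset (Fin a), (S.biUnion P).card + Sᶜ.card ≤ r := by
  classical
  by_contra! hcon
  have hra : r < a := by simpa using hcon ∅
  -- With `e` dummy columns joined to every row, the negated conclusion is Hall's condition. At most
  -- `e` rows are matched to dummies, so at least `r + 1` are matched to true columns.
  set e := a - r - 1 with he
  let t : Fin a → Finset (Fin b ⊕ Fin e) := fun i => (P i).disjSum Finset.univ
  have hHall : ∀ S : Finset (Fin a), S.card ≤ (S.biUnion t).card := by
    intro S
    rcases S.eq_empty_or_nonempty with rfl | ⟨i₀, hi₀⟩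
    · simp
    have hsub : (S.biUnion P).disjSum (Finset.univ : Finset (Fin e)) ⊆ S.biUnion t := by
      intro x hx
      rw [Finset.mem_biUnion]
      rw [Finset.mem_disjSum] at hx
      rcases hx with ⟨j, hj, rfl⟩ | ⟨j, _, rfl⟩
      · obtain ⟨i, hi, hij⟩ := Finset.mem_biUnion.1 hj
        exact ⟨i, hi, Finset.inl_mem_disjSum.2 hij⟩
      · exact ⟨i₀, hi₀, Finset.inr_mem_disjSum.2 (Finset.mem_univ _)⟩
    have h1 := Finset.card_le_card hsub
    have h2 := hcon S
    rw [Finset.card_disjSum, Finset.card_univ, Fintype.card_fin] at h1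
    rw [Finset.card_compl, Fintype.card_fin] at h2
    have h3 : S.card ≤ a := by simpa using Finset.card_le_univ S
    omega
  obtain ⟨h, hinj, hmem⟩ := (Finset.all_card_le_biUnion_card_iff_exists_injective t).1 hHall
  let S : Finset (Fin a) := Finset.univ.filter fun i => (h i).isLeft
  have hS : ∀ i : S, ∃ j, h i = Sum.inl j := fun i =>
    Sum.isLeft_iff.1 (Finset.mem_filter.1 i.2).2
  choose g hg using hS
  have h1 := hP S g (fun i j hij => Subtype.ext (hinj (by rw [hg, hg, hij]))) fun i => by
    have := hmem i
    rw [hg] at this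
    exact Finset.inl_mem_disjSum.1 this
  have h2 : Sᶜ.card ≤ e := by
    have hT : ∀ i : (Sᶜ : Finset (Fin a)), ∃ j, h i = Sum.inr j := fun i =>
      Sum.isRight_iff.1 (by simpa [S] using i.2)
    choose g' hg' using hT
    have := Fintype.card_le_of_injective g' fun i j hij =>
      Subtype.ext (hinj (by rw [hg', hg', hij]))
    rwa [Fintype.card_coe, Fintype.card_fin] at this
  rw [Finset.card_compl, Fintype.card_fin] at h2
  omega

end Koenig

open Matrix

/-! ### Matrix spaces of bounded rank and the extremal case -/

section Matrices

variable {F : Type*} [Field F] {a b r : ℕ}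

theorem vecMul_mem_span_row (M : Matrix (Fin a) (Fin b) F) (x : Fin a → F) :
    x ᵥ* M ∈ Submodule.span F (Set.range M.row) := by
  rw [Matrix.vecMul_eq_sum]
  exact Submodule.sum_mem _ fun i _ => Submodule.smul_mem _ _ (Submodule.subset_span ⟨i, rfl⟩)

theorem card_le_rank_of_linearIndependent_vecMul {ι : Type*} [Fintype ι]
    (M : Matrix (Fin a) (Fin b) F) (f : ι → Fin a → F)
    (h : LinearIndependent F fun i => f i ᵥ* M) : Fintype.card ι ≤ M.rank := by
  rw [Matrix.rank_eq_finrank_span_row, ← finrank_span_eq_card h]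
  refine Submodule.finrank_mono (Submodule.span_le.2 ?_)
  rintro _ ⟨i, rfl⟩
  exact vecMul_mem_span_row M _

theorem rank_le_of_rows_mem (M : Matrix (Fin a) (Fin b) F) (V : Submodule F (Fin b → F))
    (h : ∀ i, M i ∈ V) : M.rank ≤ Module.finrank F V := by
  rw [Matrix.rank_eq_finrank_span_row]
  refine Submodule.finrank_mono (Submodule.span_le.2 ?_)
  rintro _ ⟨i, rfl⟩
  exact h i

/-- If independent vectors `v i` are the first nonzero rows, in positions `i ∈ S`, of elements of a
space of matrices, then some element of the space has independent rows in the positions `S`. Here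
the `i`-th row is taken with respect to a family `f` of row functionals. -/
theorem exists_linearIndependent_vecMul (A : Submodule F (Matrix (Fin a) (Fin b) F))
    (f : Fin a → Fin a → F) (S : Finset (Fin a)) (v : Fin a → Fin b → F)
    (hv : ∀ i ∈ S, ∃ M ∈ A, (∀ l < i, f l ᵥ* M = 0) ∧ f i ᵥ* M = v i)
    (hli : LinearIndependent F fun i : S => v i) :
    ∃ M ∈ A, LinearIndependent F fun i : S => f i ᵥ* M := by
  -- Rows before `k` are already those of `M`, the later ones are still the prescribed `v i`. Adding
  -- the matrix belonging to row `k` leaves earlier rows unchanged and adds `v k` to row `k`; either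
  -- adding it or not preserves independence.
  have key : ∀ k ≤ a, ∃ M ∈ A, LinearIndependent F
      fun i : S => if (i : Fin a).val < k then f i ᵥ* M else v i := by
    intro k
    induction k with
    | zero => exact fun _ => ⟨0, A.zero_mem, by simpa using hli⟩
    | succ k ih =>
      intro hk
      obtain ⟨M, hM, hMli⟩ := ih (by omega)
      by_cases hkS : (⟨k, hk⟩ : Fin a) ∈ S
      · obtain ⟨N, hN, hN0, hNv⟩ := hv _ hkS
        let p : S := ⟨⟨k, hk⟩, hkS⟩
        have hne : ∀ i : S, i ≠ p → (i : Fin a).val ≠ k := fun i hi h =>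
          hi (Subtype.ext (Fin.ext h))
        rcases linearIndependent_update_or hMli p (f ⟨k, hk⟩ ᵥ* M) with h | h
        · refine ⟨M, hM, ?_⟩
          convert h using 1
          swap
          · rfl
          funext i
          by_cases hi : i = p
          · subst hi
            simp [p]
          · have := hne i hi
            rw [Function.update_of_ne hi]
            exact if_congr (by lia) rfl rfl
        · refine ⟨M + N, A.add_mem hM hN, ?_⟩
          convert h using 1
          swap
          · rfl
          funext i
          by_cases hi : i = p
          · subst hi
            simp [p, Matrix.vecMul_add, hNv]
          · have := hne i hi
            rw [Function.update_of_ne hi]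
            by_cases hik : (i : Fin a).val < k
            · rw [if_pos (by omega), if_pos hik, Matrix.vecMul_add, hN0 _ (Fin.lt_def.2 hik),
                add_zero]
            · rw [if_neg (by omega), if_neg hik]
      · refine ⟨M, hM, ?_⟩
        convert hMli using 1
        funext i
        have : (i : Fin a).val ≠ k := by
          rintro rfl
          exact hkS i.2
        exact if_congr (by omega) rfl rfl
  obtain ⟨M, hM, h⟩ := key a le_rfl
  refine ⟨M, hM, ?_⟩
  convert h using 1
  funext i
  rw [if_pos (Fin.is_lt _)]

open Classical in
/-- The leading positions, in the `i`-th row, of the elements of `A` whose previous rows vanish. -/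
noncomputable def leadingPositions (A : Submodule F (Matrix (Fin a) (Fin b) F))
    (f : Fin a → Fin a → F) (i : Fin a) : Finset (Fin b) :=
  Finset.univ.filter fun j => ∃ M ∈ A, (∀ l < i, f l ᵥ* M = 0) ∧
    (f i ᵥ* M) j ≠ 0 ∧ ∀ j' < j, (f i ᵥ* M) j' = 0

theorem exists_first_ne_zero {k : ℕ} {E : Type*} [Zero E] {x : Fin k → E} (hx : x ≠ 0) :
    ∃ j, x j ≠ 0 ∧ ∀ j' < j, x j' = 0 := by
  classical
  obtain ⟨j₀, hj₀⟩ := Function.ne_iff.1 hx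
  obtain ⟨j, hj, hmin⟩ := Finset.exists_min_image (Finset.univ.filter fun j => x j ≠ 0) id
    ⟨j₀, by simpa using hj₀⟩
  refine ⟨j, by simpa using hj, fun j' hj' => ?_⟩
  by_contra h
  exact absurd (hmin j' (by simpa using h)) (not_le.2 hj')

theorem exists_mem_leadingPositions {A : Submodule F (Matrix (Fin a) (Fin b) F)}
    {f : Fin a → Fin a → F} {i : Fin a} {M : Matrix (Fin a) (Fin b) F} (hM : M ∈ A)
    (h0 : ∀ l < i, f l ᵥ* M = 0) (hi : f i ᵥ* M ≠ 0) :
    ∃ j ∈ leadingPositions A f i, (f i ᵥ* M) j ≠ 0 := by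
  obtain ⟨j, hj, hlt⟩ := exists_first_ne_zero hi
  refine ⟨j, ?_, hj⟩
  simp only [leadingPositions, Finset.mem_filter, Finset.mem_univ, true_and]
  exact ⟨M, hM, h0, hj, hlt⟩

theorem eq_zero_of_forall_vecMul_eq_zero (f : Module.Basis (Fin a) F (Fin a → F))
    {M : Matrix (Fin a) (Fin b) F} (h : ∀ i, f i ᵥ* M = 0) : M = 0 := by
  have : M.vecMulLinear = 0 := f.ext fun i => by simpa using h i
  ext i j
  have h2 := congrFun (LinearMap.congr_fun this (Pi.single i 1)) j
  simpa using h2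

/-- A matrix in `A` is determined by its entries in the leading positions. -/
theorem finrank_le_sum_card_leadingPositions (A : Submodule F (Matrix (Fin a) (Fin b) F))
    (f : Module.Basis (Fin a) F (Fin a → F)) :
    Module.finrank F A ≤ ∑ i, (leadingPositions A f i).card := by
  let φ : A →ₗ[F] ((Σ i, leadingPositions A f i) → F) :=
    { toFun := fun M p => (f p.1 ᵥ* (M : Matrix (Fin a) (Fin b) F)) p.2
      map_add' := fun M N => by
        funext p
        simp [Matrix.vecMul_add]
      map_smul' := fun c M => by
        funext p
        simp [Matrix.vecMul_smul] }
  have hφ : Function.Injective φ := by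
    rw [injective_iff_map_eq_zero]
    intro M hM
    by_contra hne
    have hx : (fun i => f i ᵥ* (M : Matrix (Fin a) (Fin b) F)) ≠ 0 := fun h =>
      hne (Subtype.ext (eq_zero_of_forall_vecMul_eq_zero f fun i => congrFun h i))
    obtain ⟨i, hi, hlt⟩ := exists_first_ne_zero hx
    obtain ⟨j, hj, hij⟩ := exists_mem_leadingPositions M.2 hlt hi
    exact hij (congrFun hM ⟨i, ⟨j, hj⟩⟩)
  have := LinearMap.finrank_le_finrank_of_injective hφ
  simpa using this

/-- A partial transversal of the leading positions gives independent rows with distinct leading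
positions, hence an element of `A` whose rank is at least the size of the transversal. König's
theorem applies. -/
theorem exists_cover_leadingPositions (A : Submodule F (Matrix (Fin a) (Fin b) F))
    (hA : ∀ M ∈ A, M.rank ≤ r) (f : Fin a → Fin a → F) :
    ∃ S : Finset (Fin a), (S.biUnion (leadingPositions A f)).card + Sᶜ.card ≤ r := by
  refine exists_card_biUnion_add_card_compl_le _ fun S h hinj hmem => ?_
  have hex : ∀ i : S, ∃ M ∈ A, (∀ l < (i : Fin a), f l ᵥ* M = 0) ∧
      (f i ᵥ* M) (h i) ≠ 0 ∧ ∀ j' < h i, (f i ᵥ* M) j' = 0 := by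
    intro i
    have := hmem i
    simpa only [leadingPositions, Finset.mem_filter, Finset.mem_univ, true_and] using this
  choose N hN hN0 hNne hNlt using hex
  classical
  let v : Fin a → Fin b → F := fun i => if hi : i ∈ S then f i ᵥ* N ⟨i, hi⟩ else 0
  have hv : ∀ i : S, v i = f i ᵥ* N i := fun i => dif_pos i.2
  obtain ⟨M, hM, hMli⟩ := exists_linearIndependent_vecMul A f S v
    (fun i hi => ⟨N ⟨i, hi⟩, hN _, hN0 ⟨i, hi⟩, (hv ⟨i, hi⟩).symm⟩)
    (linearIndependent_of_leading _ h hinj (fun i => by rw [hv]; exact hNne i)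
      fun i j hj => by rw [hv]; exact hNlt i j hj)
  have := card_le_rank_of_linearIndependent_vecMul M (fun i : S => f i) hMli
  rw [Fintype.card_coe] at this
  exact this.trans (hA M hM)

theorem sum_card_leadingPositions_le (A : Submodule F (Matrix (Fin a) (Fin b) F))
    (f : Fin a → Fin a → F) (S : Finset (Fin a)) :
    ∑ i, (leadingPositions A f i).card ≤
      S.card * (S.biUnion (leadingPositions A f)).card + Sᶜ.card * b := by
  classical
  rw [← Finset.sum_add_sum_compl S]
  refine add_le_add ?_ ?_
  · rw [← smul_eq_mul]
    exact Finset.sum_le_card_nsmul _ _ _ fun i hi =>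
      Finset.card_le_card (Finset.subset_biUnion_of_mem _ hi)
  · rw [← smul_eq_mul]
    exact Finset.sum_le_card_nsmul _ _ _ fun i hi => by
      simpa using Finset.card_le_univ (leadingPositions A f i)

/-- A space of `a × b` matrices of rank at most `r`, where `b ≤ a`, has dimension at most `a r`. -/
theorem finrank_le_of_rank_le (hba : b ≤ a) (A : Submodule F (Matrix (Fin a) (Fin b) F))
    (hA : ∀ M ∈ A, M.rank ≤ r) : Module.finrank F A ≤ a * r := by
  let f := Pi.basisFun F (Fin a)
  obtain ⟨S, hS⟩ := exists_cover_leadingPositions A hA f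
  have h1 := finrank_le_sum_card_leadingPositions A f
  have h2 := sum_card_leadingPositions_le A f S
  have h3 : S.card ≤ a := by simpa using Finset.card_le_univ S
  calc Module.finrank F A ≤ _ := h1.trans h2
    _ ≤ a * (S.biUnion (leadingPositions A f)).card + Sᶜ.card * a := by gcongr
    _ = a * ((S.biUnion (leadingPositions A f)).card + Sᶜ.card) := by ring
    _ ≤ a * r := by gcongr

/-- In the extremal case the leading positions form either `r` columns or `r` rows. -/
theorem leadingPositions_of_finrank_eq (hb : 0 < b) (hba : b ≤ a)
    (A : Submodule F (Matrix (Fin a) (Fin b) F))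
    (hA : ∀ M ∈ A, M.rank ≤ r) (hdim : Module.finrank F A = a * r)
    (f : Module.Basis (Fin a) F (Fin a → F)) :
    (∀ i, (leadingPositions A f i).card ≤ r) ∨
      (a = b ∧ r < b ∧ ∃ S : Finset (Fin a), Sᶜ.card = r ∧ ∀ i ∈ S, leadingPositions A f i = ∅) := by
  obtain ⟨S, hS⟩ := exists_cover_leadingPositions A hA f
  by_cases hrb : b ≤ r
  · exact Or.inl fun i => (by simpa using Finset.card_le_univ (leadingPositions A f i) :
      (leadingPositions A f i).card ≤ b).trans hrb
  have h1 := (finrank_le_sum_card_leadingPositions A f).trans (sum_card_leadingPositions_le A f S)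
  rw [hdim] at h1
  have hSa : S.card + Sᶜ.card = a := by simp
  set k := (S.biUnion (leadingPositions A f)).card with hk
  set l := Sᶜ.card with hl
  have h2 : a * (k + l) ≤ S.card * k + l * b := (Nat.mul_le_mul_left a hS).trans h1
  -- Substituting `S.card = a - l` in `h2` leaves `l * k + l * (a - b) ≤ 0`: a mixed covering by
  -- rows and columns wastes dimension.
  have h3 : l * k + l * (a - b) = 0 := by
    obtain ⟨e, he⟩ := Nat.exists_eq_add_of_le hba
    have : a - b = e := by omega
    rw [this]
    nlinarith
  rcases Nat.eq_zero_or_pos l with hl0 | hl0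
  · left
    intro i
    have hi : i ∈ S := by
      by_contra hi
      have : i ∈ Sᶜ := Finset.mem_compl.2 hi
      rw [Finset.card_eq_zero.1 (hl.symm.trans hl0)] at this
      simp at this
    exact (Finset.card_le_card (Finset.subset_biUnion_of_mem _ hi)).trans (by omega)
  · right
    have hk0 : k = 0 := by nlinarith
    have hab : a - b = 0 := by
      rw [hk0, mul_zero, zero_add] at h3
      exact (Nat.mul_eq_zero.1 h3).resolve_left hl0.ne'
    have hab' : a = b := by omega
    refine ⟨hab', by omega, S, ?_, fun i hi => ?_⟩
    · refine le_antisymm (by omega) ?_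
      rw [hk0, mul_zero, zero_add, hab', mul_comm] at h1
      exact Nat.le_of_mul_le_mul_right h1 hb
    · exact Finset.subset_empty.1 ((Finset.card_eq_zero.1 (hk.symm.trans hk0)) ▸
        Finset.subset_biUnion_of_mem (leadingPositions A f) hi)

/-- Complete `g` to a basis in which it comes first. No earlier rows have to vanish, so the image of
`A` under `g` is determined by its entries in the leading positions of that first row. -/
theorem finrank_map_vecMul_le (A : Submodule F (Matrix (Fin a) (Fin b) F))
    (hcol : ∀ f : Module.Basis (Fin a) F (Fin a → F), ∀ i, (leadingPositions A f i).card ≤ r)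
    {g : Fin a → F} (hg : g ≠ 0) :
    Module.finrank F (A.map (Matrix.vecMulBilin F F g)) ≤ r := by
  obtain ⟨p, -⟩ := Function.ne_iff.1 hg
  have ha : 0 < a := Fin.pos p
  obtain ⟨y, hy, hy0⟩ := exists_linearIndependent_apply_eq (F := F) (ι := Fin a)
    (E := Fin a → F) (by simp) ⟨0, ha⟩ hg
  have : Nonempty (Fin a) := ⟨p⟩
  let f := basisOfLinearIndependentOfCardEqFinrank hy (by simp)
  have hf : f ⟨0, ha⟩ = g := by simp [f, hy0]
  let P := leadingPositions A f ⟨0, ha⟩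
  let φ : A.map (Matrix.vecMulBilin F F g) →ₗ[F] (P → F) :=
    (LinearMap.funLeft F F (Subtype.val : P → Fin b)) ∘ₗ Submodule.subtype _
  have hφ : Function.Injective φ := by
    rw [injective_iff_map_eq_zero]
    rintro ⟨x, M, hM, rfl⟩ h0
    by_contra hne
    have hi : f ⟨0, ha⟩ ᵥ* M ≠ 0 := by
      rw [hf]
      exact fun h => hne (Subtype.ext h)
    obtain ⟨j, hj, hij⟩ := exists_mem_leadingPositions (f := f) hM
      (fun l hl => absurd hl (by simp [Fin.lt_def])) hi
    rw [hf] at hij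
    exact hij (congrFun h0 ⟨j, hj⟩)
  have h1 := LinearMap.finrank_le_finrank_of_injective hφ
  rw [Module.finrank_fintype_fun_eq_card, Fintype.card_coe] at h1
  exact h1.trans (hcol f _)

/-- An extremal space whose leading positions always form columns consists of all matrices with rows
in a fixed space; the matrices with a suitable column equal to zero have smaller rank. -/
theorem exists_linearMap_of_columns (hr : 0 < r) (A : Submodule F (Matrix (Fin a) (Fin b) F))
    (hdim : Module.finrank F A = a * r)
    (hcol : ∀ f : Module.Basis (Fin a) F (Fin a → F), ∀ i, (leadingPositions A f i).card ≤ r) :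
    ∃ φ : Matrix (Fin a) (Fin b) F →ₗ[F] (Fin a → F), ∀ M ∈ A, φ M = 0 → M.rank < r := by
  rcases Nat.eq_zero_or_pos a with ha | ha
  · subst ha
    exact ⟨0, fun M _ _ => by
      have : M.rank ≤ 0 := by simpa using M.rank_le_height
      omega⟩
  let V : Fin a → Submodule F (Fin b → F) := fun i =>
    A.map (Matrix.vecMulBilin F F (Pi.single i 1))
  have hVle : ∀ i, Module.finrank F (V i) ≤ r := fun i =>
    finrank_map_vecMul_le A hcol (by simp)
  have hrow : ∀ M ∈ A, ∀ i, M i ∈ V i := fun M hM i => ⟨M, hM, by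
    simp [Matrix.vecMulBilin, Matrix.row]⟩
  -- Each `V i` has dimension at most `r` and `A` has dimension `a * r`, so this embedding is onto:
  -- the rows can be prescribed independently.
  let ψ : A →ₗ[F] ∀ i, V i :=
    { toFun := fun M i => ⟨(M : Matrix (Fin a) (Fin b) F) i, hrow M M.2 i⟩
      map_add' := fun M N => rfl
      map_smul' := fun c M => rfl }
  have hψ : Function.Injective ψ := by
    intro M N h
    ext i j
    exact congrFun (congrArg Subtype.val (congrFun h i)) j
  have hsum : ∑ i, Module.finrank F (V i) ≤ ∑ _i : Fin a, r :=
    Finset.sum_le_sum fun i _ => hVle i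
  have hge := LinearMap.finrank_le_finrank_of_injective hψ
  rw [Module.finrank_pi_fintype, hdim] at hge
  have hsum' : ∑ i, Module.finrank F (V i) = ∑ _i : Fin a, r := by
    refine le_antisymm hsum ?_
    simpa using hge
  have hVr : ∀ i, Module.finrank F (V i) = r := fun i =>
    (Finset.sum_eq_sum_iff_of_le fun i _ => hVle i).1 hsum' i (Finset.mem_univ i)
  have hsurj : Function.Surjective ψ := by
    refine (LinearMap.injective_iff_surjective_of_finrank_eq_finrank ?_).1 hψ
    rw [Module.finrank_pi_fintype, hdim, hsum']
    simp
  -- The space of sums of rows `i` and `j` contains both `V i` and `V j`, and its dimension is again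
  -- at most `r`.
  have hVeq : ∀ i j, V i = V j := by
    intro i j
    by_cases hij : i = j
    · rw [hij]
    have hg : (Pi.single i 1 + Pi.single j 1 : Fin a → F) ≠ 0 := fun h => by
      have := congrFun h i
      simp [hij] at this
    have hle := finrank_map_vecMul_le A hcol hg
    have hmem : ∀ k, (k = i ∨ k = j) →
        V k ≤ A.map (Matrix.vecMulBilin F F (Pi.single i 1 + Pi.single j 1)) := by
      intro k hk x hx
      obtain ⟨M, hM⟩ := hsurj (Pi.single k ⟨x, hx⟩)
      refine ⟨M, M.2, ?_⟩
      have hM' : ∀ l, (M : Matrix (Fin a) (Fin b) F) l =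
          ((Pi.single k ⟨x, hx⟩ : ∀ l, V l) l : Fin b → F) := fun l =>
        congrArg Subtype.val (congrFun hM l)
      have hM1 : (M : Matrix (Fin a) (Fin b) F) k = x := by rw [hM', Pi.single_eq_same]
      have hM0 : ∀ l, l ≠ k → (M : Matrix (Fin a) (Fin b) F) l = 0 := fun l hl => by
        rw [hM', Pi.single_eq_of_ne hl]
        rfl
      have : (Pi.single i 1 + Pi.single j 1 : Fin a → F) ᵥ* (M : Matrix (Fin a) (Fin b) F) =
          (M : Matrix (Fin a) (Fin b) F) i + (M : Matrix (Fin a) (Fin b) F) j := by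
        rw [Matrix.add_vecMul]
        simp [Matrix.row]
      refine this.trans ?_
      rcases hk with rfl | rfl
      · rw [hM1, hM0 j (Ne.symm hij), add_zero]
      · rw [hM1, hM0 i hij, zero_add]
    have h1 := Submodule.eq_of_le_of_finrank_le (hmem i (Or.inl rfl)) (by rw [hVr]; exact hle)
    have h2 := Submodule.eq_of_le_of_finrank_le (hmem j (Or.inr rfl)) (by rw [hVr]; exact hle)
    rw [h1, h2]
  let V₀ := V ⟨0, ha⟩
  obtain ⟨x, hx, hx0⟩ : ∃ x ∈ V₀, x ≠ 0 := by
    refine Submodule.exists_mem_ne_zero_of_ne_bot fun h => ?_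
    have := hVr ⟨0, ha⟩
    rw [show V ⟨0, ha⟩ = ⊥ from h, finrank_bot] at this
    omega
  -- Coordinate `j` is not identically zero on the common row space, so the vanishing of column `j`
  -- confines the rows to a proper subspace.
  obtain ⟨j, hj⟩ := Function.ne_iff.1 hx0
  let φ : Matrix (Fin a) (Fin b) F →ₗ[F] (Fin a → F) :=
    { toFun := fun M i => M i j
      map_add' := fun M N => rfl
      map_smul' := fun c M => rfl }
  refine ⟨φ, fun M hM h0 => ?_⟩
  refine (rank_le_of_rows_mem M (V₀ ⊓ LinearMap.ker (LinearMap.proj j)) fun i => ?_).trans_lt ?_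
  · exact ⟨(hVeq i ⟨0, ha⟩).le (hrow M hM i), congrFun h0 i⟩
  · rw [← hVr ⟨0, ha⟩]
    refine Submodule.finrank_lt_finrank_of_lt (lt_of_le_of_ne inf_le_left fun h => ?_)
    have : x ∈ V₀ ⊓ LinearMap.ker (LinearMap.proj j) := h.symm ▸ hx
    exact hj this.2

/-- An extremal space whose leading positions form rows consists of matrices whose rows are fixed
combinations of `r` rows; the matrices with one of these equal to zero have smaller rank. -/
theorem exists_linearMap_of_rows (hr : 0 < r) (hra : r < a)
    (A : Submodule F (Matrix (Fin a) (Fin a) F)) (hA : ∀ M ∈ A, M.rank ≤ r)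
    (hdim : Module.finrank F A = a * r) (f : Module.Basis (Fin a) F (Fin a → F))
    (S : Finset (Fin a)) (hS : Sᶜ.card = r) (hlead : ∀ i ∈ S, leadingPositions A f i = ∅) :
    ∃ φ : Matrix (Fin a) (Fin a) F →ₗ[F] (Fin a → F), ∀ M ∈ A, φ M = 0 → M.rank < r := by
  classical
  let T := {i // i ∈ Sᶜ}
  have hT : Fintype.card T = r := by rw [Fintype.card_coe, hS]
  -- The first nonzero row of an element of `A` lies outside `S`, so the `r` rows in `T` determine
  -- the element; by dimension they can be arbitrary.
  let ρ : A →ₗ[F] (T → Fin a → F) :=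
    LinearMap.pi fun i => Matrix.vecMulBilin F F (f i) ∘ₗ A.subtype
  have hρ : Function.Injective ρ := by
    rw [injective_iff_map_eq_zero]
    intro M hM
    by_contra hne
    have hx : (fun i => f i ᵥ* (M : Matrix (Fin a) (Fin a) F)) ≠ 0 := fun h =>
      hne (Subtype.ext (eq_zero_of_forall_vecMul_eq_zero f fun i => congrFun h i))
    obtain ⟨i, hi, hlt⟩ := exists_first_ne_zero hx
    by_cases hiS : i ∈ S
    · obtain ⟨j, hj, -⟩ := exists_mem_leadingPositions M.2 hlt hi
      rw [hlead i hiS] at hj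
      simp at hj
    · exact hi (congrFun hM ⟨i, Finset.mem_compl.2 hiS⟩)
  let e := ρ.linearEquivOfInjective hρ (by
    rw [hdim, Module.finrank_pi_fintype]
    simp [T, hS, mul_comm])
  have hey : ∀ y (i : T), f i ᵥ* (e.symm y).1 = y i := fun y i =>
    congrFun (e.apply_symm_apply y) i
  have hcomb : ∀ k, ∃ c : T → F, ∀ M ∈ A, f k ᵥ* M = ∑ i : T, c i • (f i ᵥ* M) := by
    intro k
    let L : (T → Fin a → F) →ₗ[F] (Fin a → F) :=
      Matrix.vecMulBilin F F (f k) ∘ₗ A.subtype ∘ₗ e.symm.toLinearMap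
    obtain ⟨c, hc⟩ := exists_forall_eq_sum_smul_of_mem_span (by simp [hT, hra]) L
      (fun y hy => by
        -- If the `r` chosen rows are independent, row `k` must be in their span, since otherwise
        -- the rank would be at least `r + 1`.
        by_contra hmem
        have hli := hy.option hmem
        have := card_le_rank_of_linearIndependent_vecMul (e.symm y).1
          (fun o : Option T => o.casesOn' (f k) fun i => f i) (by
            convert hli using 1
            swap
            · rfl
            funext o
            cases o with
            | none => rfl
            | some i => exact hey y i)
        rw [Fintype.card_option, hT] at this
        have := hA _ (e.symm y).2
        omega)
    refine ⟨c, fun M hM => ?_⟩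
    have h := hc (e ⟨M, hM⟩)
    simp only [L, LinearMap.comp_apply, LinearEquiv.coe_coe, LinearEquiv.symm_apply_apply] at h
    exact h
  choose c hc using hcomb
  obtain ⟨i₀⟩ : Nonempty T := Fintype.card_pos_iff.1 (by omega)
  refine ⟨Matrix.vecMulBilin F F (f i₀), fun M hM h0 => ?_⟩
  let W := Submodule.span F (Set.range fun i : {i : T // i ≠ i₀} => f i.1 ᵥ* M)
  have hW : Module.finrank F W < r := by
    refine (finrank_range_le_card _).trans_lt ?_
    rw [Fintype.card_subtype_compl, hT, Fintype.card_subtype_eq]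
    omega
  refine (rank_le_of_rows_mem M W fun j => ?_).trans_lt hW
  have hfW : ∀ k, f k ᵥ* M ∈ W := by
    intro k
    rw [hc k M hM]
    refine Submodule.sum_mem _ fun i _ => Submodule.smul_mem _ _ ?_
    by_cases hi : i = i₀
    · subst hi
      have : f i ᵥ* M = 0 := h0
      rw [this]
      exact W.zero_mem
    · exact Submodule.subset_span ⟨⟨i, hi⟩, rfl⟩
  have htop : W.comap M.vecMulLinear = ⊤ := by
    rw [eq_top_iff, ← f.span_eq, Submodule.span_le]
    rintro _ ⟨k, rfl⟩
    exact hfW k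
  have : (Pi.single j 1 : Fin a → F) ∈ W.comap M.vecMulLinear := htop ▸ Submodule.mem_top
  simpa [Matrix.row] using this

/-- The matrices of an extremal space of rank `r > 0` that satisfy some `a` linear equations have
rank less than `r`. -/
theorem exists_linearMap_rank_lt (hr : 0 < r) (hb : 0 < b) (hba : b ≤ a)
    (A : Submodule F (Matrix (Fin a) (Fin b) F)) (hA : ∀ M ∈ A, M.rank ≤ r)
    (hdim : Module.finrank F A = a * r) :
    ∃ φ : Matrix (Fin a) (Fin b) F →ₗ[F] (Fin a → F), ∀ M ∈ A, φ M = 0 → M.rank < r := by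
  by_cases hcol : ∀ f : Module.Basis (Fin a) F (Fin a → F), ∀ i, (leadingPositions A f i).card ≤ r
  · exact exists_linearMap_of_columns hr A hdim hcol
  · rw [not_forall] at hcol
    obtain ⟨f, hf⟩ := hcol
    obtain ⟨hab, hrb, S, hS, hlead⟩ :=
      (leadingPositions_of_finrank_eq hb hba A hA hdim f).resolve_left hf
    subst hab
    exact exists_linearMap_of_rows hr hrb A hA hdim f S hS hlead

end Matrices

/-! ### Optimal anticodes -/

section Anticodes

variable {F : Type*} [Field F] {a b : ℕ}

theorem bddAbove_ranks (A : Submodule F (Matrix (Fin a) (Fin b) F)) :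
    BddAbove {w | ∃ X ∈ A, X.rank = w} :=
  ⟨b, by
    rintro _ ⟨X, -, rfl⟩
    exact X.rank_le_width⟩

theorem rank_le_maxRank {A : Submodule F (Matrix (Fin a) (Fin b) F)} {X : Matrix (Fin a) (Fin b) F}
    (hX : X ∈ A) : X.rank ≤ maxRank A :=
  le_csSup (bddAbove_ranks A) ⟨X, hX, rfl⟩

theorem exists_rank_eq_maxRank (A : Submodule F (Matrix (Fin a) (Fin b) F)) :
    ∃ X ∈ A, X.rank = maxRank A :=
  Nat.sSup_mem (s := {w | ∃ X ∈ A, X.rank = w}) ⟨_, 0, A.zero_mem, rfl⟩ (bddAbove_ranks A)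

theorem maxRank_le {A : Submodule F (Matrix (Fin a) (Fin b) F)} {r : ℕ}
    (h : ∀ X ∈ A, X.rank ≤ r) : maxRank A ≤ r := by
  obtain ⟨X, hX, hr⟩ := exists_rank_eq_maxRank A
  exact hr ▸ h X hX

theorem finrank_le_mul_maxRank (hba : b ≤ a) (A : Submodule F (Matrix (Fin a) (Fin b) F)) :
    Module.finrank F A ≤ a * maxRank A :=
  finrank_le_of_rank_le hba A fun _ hX => rank_le_maxRank hX

theorem maxRank_eq_of_finrank_ge (ha : 0 < a) (hba : b ≤ a)
    {A : Submodule F (Matrix (Fin a) (Fin b) F)} {r : ℕ} (h : ∀ X ∈ A, X.rank ≤ r)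
    (hdim : a * r ≤ Module.finrank F A) : maxRank A = r :=
  le_antisymm (maxRank_le h)
    (Nat.le_of_mul_le_mul_left (hdim.trans (finrank_le_mul_maxRank hba A)) ha)

theorem isOptimalAnticode_of_finrank_ge (ha : 0 < a) (hba : b ≤ a)
    {A : Submodule F (Matrix (Fin a) (Fin b) F)} {r : ℕ} (h : ∀ X ∈ A, X.rank ≤ r)
    (hdim : a * r ≤ Module.finrank F A) : IsOptimalAnticode A :=
  le_antisymm (finrank_le_mul_maxRank hba A)
    (by rw [maxRank_eq_of_finrank_ge ha hba h hdim]; exact hdim)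

theorem finrank_le_finrank_inf_ker_add {E : Type*} [AddCommGroup E] [Module F E]
    [FiniteDimensional F E] (U : Submodule F E) (φ : E →ₗ[F] (Fin a → F)) :
    Module.finrank F U ≤ Module.finrank F (U ⊓ LinearMap.ker φ : Submodule F E) + a := by
  have h1 := Submodule.finrank_sup_add_finrank_inf_eq U (LinearMap.ker φ)
  have h2 := φ.finrank_range_add_finrank_ker
  have h3 : Module.finrank F (LinearMap.range φ) ≤ a := by
    simpa using Submodule.finrank_le (LinearMap.range φ)
  have h4 := Submodule.finrank_le (U ⊔ LinearMap.ker φ)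
  omega

/-- An optimal anticode of maximum rank `r > 0` contains one of maximum rank `r - 1`, cut out by as
many linear equations as the matrices have rows. -/
theorem exists_optimalAnticode_inf_ker (hb : 0 < b) (hba : b ≤ a)
    {A : Submodule F (Matrix (Fin a) (Fin b) F)} (hA : IsOptimalAnticode A) (hr : 0 < maxRank A) :
    ∃ φ : Matrix (Fin a) (Fin b) F →ₗ[F] (Fin a → F),
      IsOptimalAnticode (A ⊓ LinearMap.ker φ) ∧ maxRank (A ⊓ LinearMap.ker φ) + 1 = maxRank A := by
  obtain ⟨φ, hφ⟩ := exists_linearMap_rank_lt hr hb hba A (fun _ hX => rank_le_maxRank hX) hA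
  have hrank : ∀ X ∈ A ⊓ LinearMap.ker φ, X.rank ≤ maxRank A - 1 := fun X hX => by
    have := hφ X hX.1 hX.2
    omega
  -- The `a` equations cost at most `a` dimensions, so the dimension bound for the smaller rank is
  -- attained.
  have hdim : a * (maxRank A - 1) ≤ Module.finrank F
      (A ⊓ LinearMap.ker φ : Submodule F (Matrix (Fin a) (Fin b) F)) := by
    have h1 := finrank_le_finrank_inf_ker_add A φ
    have h2 : Module.finrank F A = a * maxRank A := hA
    rw [Nat.mul_sub, mul_one]
    omega
  refine ⟨φ, isOptimalAnticode_of_finrank_ge (by omega) hba hrank hdim, ?_⟩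
  rw [maxRank_eq_of_finrank_ge (by omega) hba hrank hdim]
  omega

/-- The matrices whose columns in positions `≥ s` vanish. -/
def colAnticode (F : Type*) [Field F] (a b s : ℕ) : Submodule F (Matrix (Fin a) (Fin b) F) where
  carrier := {X | ∀ (i : Fin a) (j : Fin b), s ≤ (j : ℕ) → X i j = 0}
  add_mem' := fun hX hY i j hj => by simp [hX i j hj, hY i j hj]
  zero_mem' := fun _ _ _ => rfl
  smul_mem' := fun c X hX i j hj => by simp [hX i j hj]

theorem colAnticode_mono {s s' : ℕ} (h : s ≤ s') : colAnticode F a b s ≤ colAnticode F a b s' :=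
  fun _ hX i j hj => hX i j (h.trans hj)

theorem rank_le_of_mem_colAnticode {s : ℕ} {X : Matrix (Fin a) (Fin b) F}
    (hX : X ∈ colAnticode F a b s) : X.rank ≤ s := by
  rw [← Matrix.rank_transpose]
  refine (Matrix.rank_le_card_of_support_subset Xᵀ (Finset.univ.filter fun j => (j : ℕ) < s)
    fun j hj => ?_).trans ?_
  · by_contra hjs
    apply hj
    funext i
    exact hX i j (by simpa using hjs)
  · have := Finset.card_le_card_of_injOn (s := Finset.univ.filter fun j : Fin b => (j : ℕ) < s)
      (t := Finset.range s) (fun j => (j : ℕ)) (fun j hj => by simpa using hj)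
      (fun i _ j _ h => Fin.ext h)
    simpa using this

theorem le_finrank_colAnticode {s : ℕ} (hs : s ≤ b) :
    a * s ≤ Module.finrank F (colAnticode F a b s) := by
  let φ : Matrix (Fin a) (Fin s) F →ₗ[F] colAnticode F a b s :=
    { toFun := fun X => ⟨Matrix.of fun i j => if h : (j : ℕ) < s then X i ⟨j, h⟩ else 0,
        fun i j hj => dif_neg (not_lt.2 hj)⟩
      map_add' := fun X Y => by
        apply Subtype.ext
        funext i j
        by_cases h : (j : ℕ) < s <;> simp [h]
      map_smul' := fun c X => by
        apply Subtype.ext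
        funext i j
        by_cases h : (j : ℕ) < s <;> simp [h] }
  have hφ : Function.Injective φ := by
    intro X Y h
    ext i j
    have := congrFun (congrFun (congrArg Subtype.val h) i) (Fin.castLE hs j)
    simpa [φ] using this
  have := LinearMap.finrank_le_finrank_of_injective hφ
  rw [Module.finrank_matrix] at this
  simpa using this

theorem isOptimalAnticode_colAnticode (ha : 0 < a) (hba : b ≤ a) {s : ℕ} (hs : s ≤ b) :
    IsOptimalAnticode (colAnticode F a b s) :=
  isOptimalAnticode_of_finrank_ge ha hba (fun _ hX => rank_le_of_mem_colAnticode hX)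
    (le_finrank_colAnticode hs)

end Anticodes

/-! ### Basic properties of weights and greedy subcodes -/

section Weights

variable {F : Type*} [Field F] {t : ℕ} {m n : Fin t → ℕ}

theorem srk_le_sum_maxRank {A : ∀ i : Fin t, Submodule F (Matrix (Fin (m i)) (Fin (n i)) F)}
    {X : Ambient F m n} (hX : X ∈ Submodule.pi Set.univ A) : srk X ≤ ∑ i, maxRank (A i) :=
  Finset.sum_le_sum fun i _ => rank_le_maxRank (hX i (Set.mem_univ i))

theorem maxSrk_pi (A : ∀ i : Fin t, Submodule F (Matrix (Fin (m i)) (Fin (n i)) F)) :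
    maxSrk (m := m) (n := n) (Submodule.pi Set.univ A) = ∑ i, maxRank (A i) := by
  choose X hX hXr using fun i => exists_rank_eq_maxRank (A i)
  apply le_antisymm
  · refine csSup_le (s := {w | ∃ X ∈ (Submodule.pi Set.univ A : Code F m n), srk X = w})
      ⟨_, 0, Submodule.zero_mem _, rfl⟩ ?_
    rintro _ ⟨Y, hY, rfl⟩
    exact srk_le_sum_maxRank hY
  · refine le_csSup ⟨∑ i, maxRank (A i), ?_⟩ ⟨X, fun i _ => hX i, ?_⟩
    · rintro _ ⟨Y, hY, rfl⟩
      exact srk_le_sum_maxRank hY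
    · exact Finset.sum_congr rfl fun i _ => hXr i

theorem wt_le {U : Code F m n} {A : ∀ i : Fin t, Submodule F (Matrix (Fin (m i)) (Fin (n i)) F)}
    (hA : ∀ i, IsOptimalAnticode (A i)) (hU : U ≤ Submodule.pi Set.univ A) :
    wt U ≤ ∑ i, maxRank (A i) :=
  Nat.sInf_le ⟨A, hA, hU, maxSrk_pi A⟩

theorem exists_anticode_wt (hn : ∀ i, 0 < n i) (hmn : ∀ i, n i ≤ m i) (U : Code F m n) :
    ∃ A : ∀ i : Fin t, Submodule F (Matrix (Fin (m i)) (Fin (n i)) F),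
      (∀ i, IsOptimalAnticode (A i)) ∧ U ≤ Submodule.pi Set.univ A ∧
        ∑ i, maxRank (A i) = wt U := by
  have hne : {w | ∃ A : ∀ i : Fin t, Submodule F (Matrix (Fin (m i)) (Fin (n i)) F),
      (∀ i, IsOptimalAnticode (A i)) ∧ U ≤ Submodule.pi Set.univ A ∧
        maxSrk (m := m) (n := n) (Submodule.pi Set.univ A) = w}.Nonempty :=
    ⟨_, fun i => colAnticode F (m i) (n i) (n i), fun i =>
      isOptimalAnticode_colAnticode ((hn i).trans_le (hmn i)) (hmn i) le_rfl,
      fun X _ i _ k j hj => absurd j.2 (not_lt.2 hj), rfl⟩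
  obtain ⟨A, hA, hU, hw⟩ := Nat.sInf_mem hne
  exact ⟨A, hA, hU, by rw [← maxSrk_pi, hw, wt]⟩

theorem srk_le_wt (hn : ∀ i, 0 < n i) (hmn : ∀ i, n i ≤ m i) {U : Code F m n} {X : Ambient F m n}
    (hX : X ∈ U) : srk X ≤ wt U := by
  obtain ⟨A, -, hU, hw⟩ := exists_anticode_wt hn hmn U
  exact hw ▸ srk_le_sum_maxRank (hU hX)

theorem genWeight_le {C U : Code F m n} {r : ℕ} (hU : U ≤ C) (hr : r ≤ Module.finrank F U) :
    genWeight C r ≤ wt U :=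
  Nat.sInf_le ⟨U, hU, hr, rfl⟩

theorem exists_wt_eq_genWeight {C : Code F m n} {r : ℕ} (hr : r ≤ Module.finrank F C) :
    ∃ U ≤ C, r ≤ Module.finrank F U ∧ wt U = genWeight C r := by
  have hne : {w | ∃ U : Code F m n, U ≤ C ∧ r ≤ Module.finrank F U ∧ wt U = w}.Nonempty :=
    ⟨_, C, le_rfl, hr, rfl⟩
  exact Nat.sInf_mem hne

theorem genWeight_mono (C : Code F m n) {r s : ℕ} (hrs : r ≤ s) (hs : s ≤ Module.finrank F C) :
    genWeight C r ≤ genWeight C s := by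
  obtain ⟨U, hU, hsU, hw⟩ := exists_wt_eq_genWeight hs
  exact hw ▸ genWeight_le hU (hrs.trans hsU)

/-- A chain of subcodes that attain the generalized weights consists of greedy subcodes. -/
theorem isGreedySubcode_of_chain {C : Code F m n} (U : ℕ → Code F m n) {k : ℕ}
    (hUC : ∀ r ≤ k, U r ≤ C) (hmono : ∀ r < k, U r ≤ U (r + 1))
    (hdim : ∀ r ≤ k, Module.finrank F (U r) = r)
    (hwt : ∀ r, 1 ≤ r → r ≤ k → wt (U r) = genWeight C r) :
    ∀ r, 1 ≤ r → r ≤ k → IsGreedySubcode C r (U r)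
  | 0, h, _ => absurd h (by omega)
  | 1, _, hk => ⟨hUC 1 hk, hdim 1 hk, hwt 1 le_rfl hk⟩
  | r + 2, _, hk => by
    refine ⟨⟨hUC _ hk, hdim _ hk, U (r + 1), hmono _ (by omega),
      isGreedySubcode_of_chain U hUC hmono hdim hwt (r + 1) (by omega) (by omega)⟩, ?_⟩
    rintro U' ⟨hU', hdim', -⟩
    rw [hwt _ (by omega) hk]
    exact genWeight_le hU' hdim'.ge

end Weights

/-! ### Counting the first `w` columns over all blocks -/

section Columns

variable {t : ℕ} {m n : Fin t → ℕ}

/-- The number of columns in the `i`-th block among the first `w` columns. -/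
def prefixCols (n : Fin t → ℕ) (w : ℕ) (i : Fin t) : ℕ := min (n i) (w - ∑ l ∈ Finset.Iio i, n l)

/-- The dimension of the space of matrix tuples supported on the first `w` columns. -/
def prefixDim (m n : Fin t → ℕ) (w : ℕ) : ℕ := ∑ i, m i * prefixCols n w i

theorem prefixCols_le (n : Fin t → ℕ) (w : ℕ) (i : Fin t) : prefixCols n w i ≤ n i :=
  min_le_left _ _

theorem prefixCols_mono (n : Fin t → ℕ) (i : Fin t) {w w' : ℕ} (h : w ≤ w') :
    prefixCols n w i ≤ prefixCols n w' i :=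
  min_le_min_left _ (Nat.sub_le_sub_right h _)

theorem prefixDim_mono (m n : Fin t → ℕ) {w w' : ℕ} (h : w ≤ w') :
    prefixDim m n w ≤ prefixDim m n w' :=
  Finset.sum_le_sum fun i _ => Nat.mul_le_mul_left _ (prefixCols_mono n i h)

theorem sum_eq_Iio_add_Ici (g : Fin t → ℕ) (j : Fin t) :
    ∑ i, g i = ∑ i ∈ Finset.Iio j, g i + ∑ i ∈ Finset.Ici j, g i := by
  rw [← Finset.sum_union (Finset.disjoint_left.2 fun i hi hi' => by
    rw [Finset.mem_Iio] at hi
    rw [Finset.mem_Ici] at hi'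
    exact absurd hi (not_lt.2 hi'))]
  refine Finset.sum_congr ?_ fun _ _ => rfl
  ext i
  simpa using lt_or_ge i j

theorem sum_Ici_eq_add_Ioi (g : Fin t → ℕ) (j : Fin t) :
    ∑ i ∈ Finset.Ici j, g i = g j + ∑ i ∈ Finset.Ioi j, g i := by
  rw [← Finset.Ioi_insert, Finset.sum_insert (by simp)]

theorem sum_Iio_add_le_sum_Iio {i j : Fin t} (h : i < j) :
    ∑ l ∈ Finset.Iio i, n l + n i ≤ ∑ l ∈ Finset.Iio j, n l := by
  rw [add_comm, ← Finset.sum_insert (s := Finset.Iio i) (a := i) (by simp)]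
  refine Finset.sum_le_sum_of_subset fun l hl => ?_
  rw [Finset.mem_insert, Finset.mem_Iio] at hl
  rw [Finset.mem_Iio]
  rcases hl with rfl | hl
  · exact h
  · exact hl.trans h

/-- The coefficients `g` are arbitrary because `g = m` computes dimensions while `g = 1` counts
columns. -/
theorem sum_mul_prefixCols {g : Fin t → ℕ} {j : Fin t} {δ : ℕ} (hδ : δ ≤ n j) :
    ∑ i, g i * prefixCols n (∑ l ∈ Finset.Iio j, n l + δ) i =
      ∑ i ∈ Finset.Iio j, g i * n i + g j * δ := by
  rw [sum_eq_Iio_add_Ici _ j, sum_Ici_eq_add_Ioi]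
  congr 1
  · refine Finset.sum_congr rfl fun i hi => ?_
    have := sum_Iio_add_le_sum_Iio (n := n) (Finset.mem_Iio.1 hi)
    rw [prefixCols, min_eq_left (by omega)]
  · have h0 : ∑ i ∈ Finset.Ioi j, g i * prefixCols n (∑ l ∈ Finset.Iio j, n l + δ) i = 0 := by
      refine Finset.sum_eq_zero fun i hi => ?_
      have := sum_Iio_add_le_sum_Iio (n := n) (Finset.mem_Ioi.1 hi)
      rw [prefixCols, Nat.sub_eq_zero_of_le (by omega), Nat.min_zero, mul_zero]
    rw [h0, add_zero, prefixCols, Nat.add_sub_cancel_left, min_eq_right hδ]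

theorem exists_eq_sum_Iio_add {w : ℕ} (hw : 0 < w) (hwn : w ≤ ∑ i, n i) :
    ∃ (j : Fin t) (δ : ℕ), δ < n j ∧ w = ∑ l ∈ Finset.Iio j, n l + δ + 1 := by
  have ht : 0 < t := by
    rcases Nat.eq_zero_or_pos t with rfl | ht
    · simp at hwn
      omega
    · exact ht
  obtain ⟨j, hj, hmax⟩ := Finset.exists_max_image
    (Finset.univ.filter fun j => ∑ l ∈ Finset.Iio j, n l < w) id ⟨⟨0, ht⟩, by
      have : Finset.Iio (⟨0, ht⟩ : Fin t) = ∅ := by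
        ext i
        simp [Fin.lt_def]
      simpa [this] using hw⟩
  have hjw : ∑ l ∈ Finset.Iio j, n l < w := by simpa using hj
  refine ⟨j, w - ∑ l ∈ Finset.Iio j, n l - 1, ?_, by omega⟩
  by_contra hcon
  have hlt : ∑ l ∈ Finset.Iio j, n l + n j < w := by omega
  by_cases hjt : j.1 + 1 < t
  · have hIio : Finset.Iio (⟨j + 1, hjt⟩ : Fin t) = insert j (Finset.Iio j) := by
      ext i
      simp only [Finset.mem_Iio, Finset.mem_insert, Fin.lt_def, Fin.ext_iff]
      omega
    have := hmax ⟨j + 1, hjt⟩ (by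
      rw [Finset.mem_filter, hIio, Finset.sum_insert (by simp)]
      exact ⟨Finset.mem_univ _, by omega⟩)
    simp [Fin.le_def] at this
  · have hIoi : Finset.Ioi j = ∅ := by
      ext i
      simp only [Finset.mem_Ioi, Fin.lt_def, Finset.notMem_empty, iff_false]
      omega
    rw [sum_eq_Iio_add_Ici _ j, sum_Ici_eq_add_Ioi, hIoi, Finset.sum_empty] at hwn
    omega

theorem prefixDim_succ {j : Fin t} {δ : ℕ} (hδ : δ < n j) :
    prefixDim m n (∑ l ∈ Finset.Iio j, n l + δ + 1) =
      prefixDim m n (∑ l ∈ Finset.Iio j, n l + δ) + m j := by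
  rw [prefixDim, prefixDim, add_assoc, sum_mul_prefixCols (Nat.succ_le_of_lt hδ),
    sum_mul_prefixCols hδ.le, Nat.mul_succ, add_assoc]

theorem sum_prefixCols {w : ℕ} (hwn : w ≤ ∑ i, n i) : ∑ i, prefixCols n w i = w := by
  rcases Nat.eq_zero_or_pos w with rfl | hw
  · simp [prefixCols]
  obtain ⟨j, δ, hδ, rfl⟩ := exists_eq_sum_Iio_add hw hwn
  have := sum_mul_prefixCols (g := fun _ => 1) (n := n) (j := j) (δ := δ + 1) hδ
  simpa [add_assoc] using this

theorem prefixDim_sum : prefixDim m n (∑ i, n i) = ∑ i, m i * n i := by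
  refine Finset.sum_congr rfl fun i _ => ?_
  have := sum_eq_Iio_add_Ici n i
  rw [sum_Ici_eq_add_Ioi] at this
  rw [prefixCols, min_eq_left (by omega)]

end Columns

/-! ### Codes on the first columns and the bound on multiplicities -/

section Codes

variable {F : Type*} [Field F] {t : ℕ} {m n : Fin t → ℕ}

/-- The tuples of matrices supported on the first `w` columns. -/
def prefixCode (F : Type*) [Field F] {t : ℕ} (m n : Fin t → ℕ) (w : ℕ) : Code F m n :=
  Submodule.pi Set.univ fun i => colAnticode F (m i) (n i) (prefixCols n w i)

theorem prefixCode_mono {w w' : ℕ} (h : w ≤ w') : prefixCode F m n w ≤ prefixCode F m n w' :=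
  fun _ hX i hi => colAnticode_mono (prefixCols_mono n i h) (hX i hi)

theorem srk_le_of_mem_prefixCode {w : ℕ} (hw : w ≤ ∑ i, n i) {X : Ambient F m n}
    (hX : X ∈ prefixCode F m n w) : srk X ≤ w :=
  (Finset.sum_le_sum fun i _ => rank_le_of_mem_colAnticode (hX i (Set.mem_univ i))).trans
    (sum_prefixCols hw).le

theorem le_finrank_prefixCode (w : ℕ) :
    prefixDim m n w ≤ Module.finrank F (prefixCode F m n w) := by
  let φ : (∀ i, colAnticode F (m i) (n i) (prefixCols n w i)) →ₗ[F] prefixCode F m n w :=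
    { toFun := fun X => ⟨fun i => X i, fun i _ => (X i).2⟩
      map_add' := fun _ _ => rfl
      map_smul' := fun _ _ => rfl }
  have hφ : Function.Injective φ := fun X Y h =>
    funext fun i => Subtype.ext (congrFun (congrArg Subtype.val h) i)
  have := LinearMap.finrank_le_finrank_of_injective hφ
  rw [Module.finrank_pi_fintype] at this
  exact (Finset.sum_le_sum fun i _ => le_finrank_colAnticode (prefixCols_le n w i)).trans this

theorem wt_le_of_le_prefixCode (hn : ∀ i, 0 < n i) (hmn : ∀ i, n i ≤ m i) {w : ℕ}
    (hw : w ≤ ∑ i, n i) {U : Code F m n} (hU : U ≤ prefixCode F m n w) : wt U ≤ w :=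
  (wt_le (fun i => isOptimalAnticode_colAnticode ((hn i).trans_le (hmn i)) (hmn i)
    (prefixCols_le n w i)) hU).trans
    ((Finset.sum_le_sum fun _ _ => maxRank_le fun _ hX => rank_le_of_mem_colAnticode hX).trans
      (sum_prefixCols hw).le)

theorem wt_le_sum (hn : ∀ i, 0 < n i) (hmn : ∀ i, n i ≤ m i) (U : Code F m n) :
    wt U ≤ ∑ i, n i := by
  refine wt_le_of_le_prefixCode hn hmn le_rfl fun X _ i _ k j hj => ?_
  have := sum_eq_Iio_add_Ici n i
  rw [sum_Ici_eq_add_Ioi] at this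
  rw [prefixCols, min_eq_left (by omega)] at hj
  exact absurd j.2 (not_lt.2 hj)

theorem finrank_ambient : Module.finrank F (Ambient F m n) = ∑ i, m i * n i := by
  rw [Module.finrank_pi_fintype]
  exact Finset.sum_congr rfl fun i _ => by simp [Module.finrank_matrix]

/-- Equality in the Singleton bound: the codimension is that of the tuples supported on the first
`minDist C - 1` columns. This form no longer mentions `j` and `δ`. -/
theorem IsMSRD.finrank_add_prefixDim {C : Code F m n} (hC : IsMSRD C) :
    Module.finrank F C + prefixDim m n (minDist C - 1) = ∑ i, m i * n i := by
  obtain ⟨j, δ, hδ, hd, hdim⟩ := hC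
  rw [hd, Nat.add_sub_cancel, prefixDim, sum_mul_prefixCols hδ.le, sum_eq_Iio_add_Ici _ j, ← hdim]
  ring

theorem IsMSRD.minDist_pos {C : Code F m n} (hC : IsMSRD C) : 0 < minDist C := by
  obtain ⟨j, δ, hδ, hd, hdim⟩ := hC
  omega

theorem IsMSRD.minDist_le {C : Code F m n} (hC : IsMSRD C) : minDist C ≤ ∑ i, n i := by
  obtain ⟨j, δ, hδ, hd, hdim⟩ := hC
  rw [hd, sum_eq_Iio_add_Ici _ j, sum_Ici_eq_add_Ioi]
  omega

theorem minDist_le_srk {C : Code F m n} {X : Ambient F m n} (hX : X ∈ C) (h0 : X ≠ 0) :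
    minDist C ≤ srk X :=
  Nat.sInf_le ⟨X, hX, h0, rfl⟩

/-- At most `prefixDim w - prefixDim (w - 1)` consecutive generalized weights of a code are equal
to `w`. -/
theorem genWeight_lt_of_genWeight_add_eq (hn : ∀ i, 0 < n i) (hm : Antitone m)
    (hmn : ∀ i, n i ≤ m i) (C : Code F m n) {r w : ℕ} (hw : 0 < w)
    (hr : r + (prefixDim m n w - prefixDim m n (w - 1)) ≤ Module.finrank F C)
    (h : genWeight C (r + (prefixDim m n w - prefixDim m n (w - 1))) = w) :
    genWeight C r < w := by
  obtain ⟨U, hUC, hUr, hUw⟩ := exists_wt_eq_genWeight hr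
  rw [h] at hUw
  have hwn : w ≤ ∑ i, n i := hUw ▸ wt_le_sum hn hmn U
  obtain ⟨j, δ, hδ, hwj⟩ := exists_eq_sum_Iio_add hw hwn
  -- Column `w` lies in block `j`, so it contributes `m j` dimensions.
  have hc : prefixDim m n w - prefixDim m n (w - 1) = m j := by
    rw [hwj, Nat.add_sub_cancel, prefixDim_succ hδ, Nat.add_sub_cancel_left]
  rw [hc] at hUr
  obtain ⟨A, hA, hUA, hAw⟩ := exists_anticode_wt hn hmn U
  rw [hUw] at hAw
  -- The blocks before `j` contain fewer than `w` columns, so they cannot carry total maximum rank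
  -- `w`.
  obtain ⟨i, hji, hi⟩ : ∃ i, j ≤ i ∧ 0 < maxRank (A i) := by
    by_contra! hcon
    have h1 : ∑ i ∈ Finset.Ici j, maxRank (A i) = 0 :=
      Finset.sum_eq_zero fun i hi => Nat.le_zero.1 (hcon i (Finset.mem_Ici.1 hi))
    have h2 : ∑ i ∈ Finset.Iio j, maxRank (A i) ≤ ∑ i ∈ Finset.Iio j, n i :=
      Finset.sum_le_sum fun i _ => maxRank_le fun X _ => X.rank_le_width
    rw [sum_eq_Iio_add_Ici _ j, h1] at hAw
    omega
  obtain ⟨φ, hφ, hφr⟩ := exists_optimalAnticode_inf_ker (hn i) (hmn i) (hA i) hi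
  let U' : Code F m n := U ⊓ LinearMap.ker (φ ∘ₗ LinearMap.proj i)
  have hU'dim : r ≤ Module.finrank F U' := by
    -- The cut costs at most `m i` dimensions, and `m i ≤ m j` since `m` is antitone.
    have h1 := finrank_le_finrank_inf_ker_add U (φ ∘ₗ LinearMap.proj i)
    have h2 := hm hji
    change _ ≤ Module.finrank F U' + _ at h1
    omega
  let A' := Function.update A i (A i ⊓ LinearMap.ker φ)
  have hA' : ∀ l, IsOptimalAnticode (A' l) := by
    intro l
    by_cases hl : l = i
    · subst hl
      simpa [A'] using hφ
    · simpa [A', hl] using hA l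
  have hUA' : U' ≤ Submodule.pi Set.univ A' := by
    intro X hX l _
    by_cases hl : l = i
    · subst hl
      simp only [A', Function.update_self]
      exact ⟨hUA hX.1 l (Set.mem_univ l), hX.2⟩
    · simp only [A', Function.update_of_ne hl]
      exact hUA hX.1 l (Set.mem_univ l)
  have hsum : ∑ l, maxRank (A' l) + 1 = w := by
    rw [← hAw, Fintype.sum_eq_add_sum_compl i, Fintype.sum_eq_add_sum_compl i, add_right_comm]
    congr 1
    · simpa [A'] using hφr
    · refine Finset.sum_congr rfl fun l hl => ?_
      have : l ≠ i := by simpa using hl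
      simp only [A', Function.update_of_ne this]
  have h1 := wt_le hA' hUA'
  have h2 : genWeight C r ≤ wt U' := genWeight_le (inf_le_left.trans hUC) hU'dim
  omega

theorem count_ofFn {k : ℕ} (g : Fin k → ℕ) (w : ℕ) :
    (List.ofFn g).count w = (Finset.univ.filter fun s => g s = w).card := by
  rw [← Multiset.coe_count, ← Fin.univ_val_map, Multiset.count_map]
  simp only [eq_comm]
  rfl

/-- By monotonicity, two indices with weight `w` at distance at least `c` would force weight `w`
also exactly `c` places before the later one, against `genWeight_lt_of_genWeight_add_eq`. -/
theorem count_genWeights_le (hn : ∀ i, 0 < n i) (hm : Antitone m) (hmn : ∀ i, n i ≤ m i)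
    (C : Code F m n) {w : ℕ} (hw : 0 < w) :
    (genWeights C).count w ≤ prefixDim m n w - prefixDim m n (w - 1) := by
  set c := prefixDim m n w - prefixDim m n (w - 1) with hc
  rw [genWeights, count_ofFn]
  set T := Finset.univ.filter fun s : Fin (Module.finrank F C) => genWeight C (s + 1) = w with hT
  rcases T.eq_empty_or_nonempty with hE | hne
  · simp [hE]
  obtain ⟨s₀, hs₀, hmin⟩ := Finset.exists_min_image T id hne
  have hs₀w : genWeight C (s₀ + 1) = w := by simpa [hT] using hs₀
  have := Finset.card_le_card_of_injOn (s := T) (t := Finset.Ico s₀.1 (s₀.1 + c))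
    (fun s => s.1) (fun s hs => ?_) (fun s _ s' _ h => Fin.ext h)
  · simpa using this
  · have hsw : genWeight C (s + 1) = w := by simpa [hT] using hs
    have hle : s₀.1 ≤ s.1 := hmin s hs
    simp only [Finset.coe_Ico, Set.mem_Ico]
    refine ⟨hle, ?_⟩
    by_contra! hcon
    have heq : s.1 + 1 - c + c = s.1 + 1 := by omega
    have hlt := genWeight_lt_of_genWeight_add_eq hn hm hmn C (r := s.1 + 1 - c) hw
      (by rw [← hc, heq]; exact s.2) (by rw [← hc, heq]; exact hsw)
    have := genWeight_mono C (r := s₀.1 + 1) (s := s.1 + 1 - c) (by omega)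
      (by have := s.2; omega)
    omega

end Codes

/-! ### Bases adapted to a chain of codes of maximal dimension -/

section Chains

variable {F : Type*} [Field F] {t : ℕ} {m n : Fin t → ℕ}

/-- A descending chain of codes `E h`, `d ≤ h ≤ n + 1`, of minimum distance at least `h` and of the
largest possible dimension; the last one is zero. -/
structure IsMaximalChain (d : ℕ) (E : ℕ → Code F m n) : Prop where
  pos : 0 < d
  anti : ∀ h h', d ≤ h → h ≤ h' → E h' ≤ E h
  le_srk : ∀ h, d ≤ h → ∀ X ∈ E h, X ≠ 0 → h ≤ srk X
  finrank_add : ∀ h, d ≤ h → h ≤ ∑ i, n i + 1 →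
    Module.finrank F (E h) + prefixDim m n (h - 1) = ∑ i, m i * n i

/-- A family of vectors `x s` of weight `g s` taken from the codes of a chain, each supported on the
first `g s` columns. -/
structure IsAdapted (d : ℕ) (E : ℕ → Code F m n) {k : ℕ} (g : Fin k → ℕ)
    (x : Fin k → Ambient F m n) : Prop where
  mono : Monotone g
  linearIndependent : LinearIndependent F x
  ge : ∀ s, d ≤ g s
  le : ∀ s, g s ≤ ∑ i, n i
  mem : ∀ s, x s ∈ E (g s)
  mem_prefixCode : ∀ s, x s ∈ prefixCode F m n (g s)

theorem IsAdapted.comp {d : ℕ} {E : ℕ → Code F m n} {k l : ℕ} {g : Fin k → ℕ}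
    {x : Fin k → Ambient F m n} (h : IsAdapted d E g x) (e : Fin l ↪o Fin k) :
    IsAdapted d E (g ∘ e) (x ∘ e) where
  mono := h.mono.comp e.monotone
  linearIndependent := h.linearIndependent.comp e e.injective
  ge _ := h.ge _
  le _ := h.le _
  mem _ := h.mem _
  mem_prefixCode _ := h.mem_prefixCode _

theorem exists_linearIndependent_of_le_finrank {E : Type*} [AddCommGroup E] [Module F E]
    [FiniteDimensional F E] {c : ℕ} (B : Submodule F E) (hc : c ≤ Module.finrank F B) :
    ∃ x : Fin c → E, LinearIndependent F x ∧ ∀ s, x s ∈ B := by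
  have e : Fin c ↪ Fin (Module.finrank F B) := Fin.castLEEmb hc
  exact ⟨fun s => Module.finBasis F B (e s),
    ((Module.finBasis F B).linearIndependent.comp e e.injective).map' B.subtype B.ker_subtype,
    fun s => (Module.finBasis F B (e s)).2⟩

/-- Descending induction on `h`: a basis of `E (h + 1)` is preceded by new vectors from `E h`
supported on the first `h` columns, as many as the dimension grows. -/
theorem IsMaximalChain.exists_isAdapted {d : ℕ} {E : ℕ → Code F m n} (hE : IsMaximalChain d E)
    {h : ℕ} (hdh : d ≤ h) (hh : h ≤ ∑ i, n i + 1) :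
    ∃ (g : Fin (Module.finrank F (E h)) → ℕ) (x : Fin (Module.finrank F (E h)) → Ambient F m n),
      IsAdapted h E g x ∧ ∀ w, h ≤ w → w ≤ ∑ i, n i →
        (List.ofFn g).count w = prefixDim m n w - prefixDim m n (w - 1) := by
  -- A free length `k` lets the induction append families without transport along equalities of
  -- dimensions.
  suffices ∃ (k : ℕ) (_ : k = Module.finrank F (E h)) (g : Fin k → ℕ)
      (x : Fin k → Ambient F m n),
      IsAdapted h E g x ∧ ∀ w, h ≤ w → w ≤ ∑ i, n i →
        (List.ofFn g).count w = prefixDim m n w - prefixDim m n (w - 1) by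
    obtain ⟨k, rfl, hk⟩ := this
    exact hk
  induction hq : ∑ i, n i + 1 - h generalizing h with
  | zero =>
    -- One step past the last column the code is zero, and the empty family is its basis.
    have hh' : h = ∑ i, n i + 1 := by omega
    have h1 := hE.finrank_add h hdh hh
    rw [hh', Nat.add_sub_cancel, prefixDim_sum] at h1
    refine ⟨0, by rw [hh']; omega, Fin.elim0, Fin.elim0, ⟨fun s => s.elim0,
      linearIndependent_empty_type, fun s => s.elim0, fun s => s.elim0, fun s => s.elim0,
      fun s => s.elim0⟩, fun w hw hw' => by omega⟩
  | succ q ih =>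
    have hhn : h ≤ ∑ i, n i := by omega
    obtain ⟨k, hk, g, x, hgx, hcount⟩ := ih (h := h + 1) (by omega) (by omega) (by omega)
    have hpos := hE.pos
    set c := prefixDim m n h - prefixDim m n (h - 1) with hc
    have hmono := prefixDim_mono m n (Nat.sub_le h 1)
    have hd1 := hE.finrank_add h hdh hh
    have hd2 := hE.finrank_add (h + 1) (by omega) (by omega)
    rw [Nat.add_sub_cancel] at hd2
    -- The dimensions of `E h` and of the prefix code together exceed that of the ambient space by
    -- at least `c`.
    have hB : c ≤ Module.finrank F (E h ⊓ prefixCode F m n h : Code F m n) := by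
      have h1 := Submodule.finrank_sup_add_finrank_inf_eq (E h) (prefixCode F m n h)
      have h2 := Submodule.finrank_le (E h ⊔ prefixCode F m n h)
      rw [finrank_ambient] at h2
      have h3 := le_finrank_prefixCode (F := F) (m := m) (n := n) h
      omega
    obtain ⟨y, hy, hyB⟩ := exists_linearIndependent_of_le_finrank _ hB
    refine ⟨c + k, by omega, Fin.append (fun _ => h) g, Fin.append y x, ⟨?_, ?_, ?_, ?_, ?_, ?_⟩, ?_⟩
    · intro s s'
      induction s using Fin.addCases with
      | left s =>
        induction s' using Fin.addCases with
        | left s' => simp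
        | right s' =>
          intro _
          simpa using (Nat.le_succ h).trans (hgx.ge s')
      | right s =>
        induction s' using Fin.addCases with
        | left s' =>
          intro hle
          have := s'.2
          simp only [Fin.le_def, Fin.val_natAdd, Fin.val_castAdd] at hle
          omega
        | right s' =>
          intro hle
          have hss : s ≤ s' := by
            rw [Fin.le_def] at hle ⊢
            simpa using hle
          simpa using hgx.mono hss
    · have hdisj : Disjoint (Submodule.span F (Set.range y)) (Submodule.span F (Set.range x)) := by
        have h1 : Submodule.span F (Set.range y) ≤ prefixCode F m n h :=
          Submodule.span_le.2 (by rintro _ ⟨s, rfl⟩; exact (Submodule.mem_inf.1 (hyB s)).2)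
        have h2 : Submodule.span F (Set.range x) ≤ E (h + 1) :=
          Submodule.span_le.2 (by
            rintro _ ⟨s, rfl⟩
            exact hE.anti _ _ (by omega) (hgx.ge s) (hgx.mem s))
        rw [Submodule.disjoint_def]
        intro X hX hX'
        by_contra hne
        have h3 := srk_le_of_mem_prefixCode hhn (h1 hX)
        have h4 := hE.le_srk (h + 1) (by omega) X (h2 hX') hne
        omega
      have := (hy.sum_type hgx.linearIndependent hdisj).comp finSumFinEquiv.symm
        finSumFinEquiv.symm.injective
      have heq : Fin.append y x = Sum.elim y x ∘ finSumFinEquiv.symm := by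
        funext s
        induction s using Fin.addCases <;> simp
      rw [heq]
      exact this
    · intro s
      induction s using Fin.addCases with
      | left s => simp
      | right s => simpa using (Nat.le_succ h).trans (hgx.ge s)
    · intro s
      induction s using Fin.addCases with
      | left s => simpa using hhn
      | right s => simpa using hgx.le s
    · intro s
      induction s using Fin.addCases with
      | left s => simpa using (hyB s).1
      | right s => simpa using hgx.mem s
    · intro s
      induction s using Fin.addCases with
      | left s => simpa using (hyB s).2
      | right s => simpa using hgx.mem_prefixCode s
    · intro w hw hwn
      rw [List.ofFn_fin_append, List.ofFn_const, List.count_append, List.count_replicate]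
      by_cases hwh : w = h
      · subst hwh
        have h0 : (List.ofFn g).count w = 0 := by
          rw [List.count_eq_zero, List.mem_ofFn]
          rintro ⟨s, hs⟩
          have := hgx.ge s
          omega
        simp [h0, hc]
      · rw [hcount w (by omega) hwn]
        simp [Ne.symm hwh]

/-! ### Generalized and greedy weights of the span of an adapted family -/

section Adapted

variable {d k : ℕ} {E : ℕ → Code F m n} {g : Fin k → ℕ} {x : Fin k → Ambient F m n}

/-- The span of the first `r` vectors of a family. -/
def initialSpan (x : Fin k → Ambient F m n) (r : ℕ) : Code F m n :=
  Submodule.span F (x '' {s | s.1 < r})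

theorem initialSpan_mono (x : Fin k → Ambient F m n) {r r' : ℕ} (h : r ≤ r') :
    initialSpan x r ≤ initialSpan x r' :=
  Submodule.span_mono (Set.image_mono fun _ hs => lt_of_lt_of_le hs h)

theorem initialSpan_card (x : Fin k → Ambient F m n) :
    initialSpan x k = Submodule.span F (Set.range x) := by
  rw [initialSpan, ← Set.image_univ]
  congr 2
  ext s
  simp

theorem initialSpan_le (x : Fin k → Ambient F m n) (r : ℕ) :
    initialSpan x r ≤ Submodule.span F (Set.range x) :=
  Submodule.span_mono (Set.image_subset_range _ _)

theorem finrank_span_image_eq {x : Fin k → Ambient F m n} (hx : LinearIndependent F x)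
    (S : Finset (Fin k)) : Module.finrank F (Submodule.span F (x '' S)) = S.card := by
  have h := finrank_span_eq_card (hx.comp (fun s : S => (s : Fin k)) Subtype.val_injective)
  have hrange : Set.range (x ∘ fun s : S => (s : Fin k)) = x '' S := by
    rw [Set.range_comp]
    congr 1
    exact Subtype.range_coe
  rwa [Fintype.card_coe, hrange] at h

theorem finrank_initialSpan (hx : LinearIndependent F x) {r : ℕ} (hr : r ≤ k) :
    Module.finrank F (initialSpan x r) = r := by
  have h := finrank_span_image_eq hx (Finset.univ.filter fun s : Fin k => s.1 < r)
  have hset : ((Finset.univ.filter fun s : Fin k => s.1 < r : Finset (Fin k)) : Set (Fin k)) =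
      {s | s.1 < r} := by
    ext s
    simp
  rwa [hset, Fin.card_filter_val_lt, min_eq_right hr] at h

/-- By dimension, `U` meets the span `T` of the vectors with index at least `r`. As `T ≤ E (g r)`, a
nonzero common element has sum-rank at least `g r`, and its sum-rank is at most `wt U`. -/
theorem IsAdapted.le_wt (hn : ∀ i, 0 < n i) (hmn : ∀ i, n i ≤ m i) (hE : IsMaximalChain d E)
    (h : IsAdapted d E g x) (r : Fin k) {U : Code F m n} (hU : U ≤ Submodule.span F (Set.range x))
    (hr : r.1 + 1 ≤ Module.finrank F U) : g r ≤ wt U := by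
  by_contra! hlt
  let T : Code F m n := Submodule.span F (x '' (Finset.Ici r : Finset (Fin k)))
  have hTdim : Module.finrank F T = k - r.1 := by
    rw [finrank_span_image_eq h.linearIndependent, Fin.card_Ici]
  have hTE : T ≤ E (g r) := by
    refine Submodule.span_le.2 ?_
    rintro _ ⟨s, hs, rfl⟩
    exact hE.anti _ _ (h.ge r) (h.mono (by simpa using hs)) (h.mem s)
  have hinf : U ⊓ T = ⊥ := by
    rw [eq_bot_iff]
    rintro X ⟨hXU, hXT⟩
    by_contra hne
    have h1 := hE.le_srk _ (h.ge r) X (hTE hXT) hne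
    have h2 := srk_le_wt hn hmn hXU
    omega
  have h1 := Submodule.finrank_sup_add_finrank_inf_eq U T
  have h2 : U ⊔ T ≤ Submodule.span F (Set.range x) :=
    sup_le hU (Submodule.span_mono (Set.image_subset_range _ _))
  have h3 := Submodule.finrank_mono h2
  rw [finrank_span_eq_card h.linearIndependent, Fintype.card_fin] at h3
  rw [hinf, finrank_bot, hTdim] at h1
  have := r.2
  omega

/-- Since `g` is monotone, the first `r + 1` vectors are all supported on the first `g r` columns;
this bounds the weight from above. -/
theorem IsAdapted.wt_initialSpan (hn : ∀ i, 0 < n i) (hmn : ∀ i, n i ≤ m i)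
    (hE : IsMaximalChain d E) (h : IsAdapted d E g x) (r : Fin k) :
    wt (initialSpan x (r + 1)) = g r := by
  refine le_antisymm (wt_le_of_le_prefixCode hn hmn (h.le r) ?_)
    (h.le_wt hn hmn hE r (initialSpan_le x _) (finrank_initialSpan h.linearIndependent r.2).ge)
  refine Submodule.span_le.2 ?_
  rintro _ ⟨s, hs, rfl⟩
  exact prefixCode_mono (h.mono (Fin.le_def.2 (Nat.lt_succ_iff.1 hs))) (h.mem_prefixCode s)

theorem IsAdapted.genWeight_eq (hn : ∀ i, 0 < n i) (hmn : ∀ i, n i ≤ m i)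
    (hE : IsMaximalChain d E) (h : IsAdapted d E g x) (r : Fin k) :
    genWeight (Submodule.span F (Set.range x)) (r + 1) = g r := by
  apply le_antisymm
  · rw [← h.wt_initialSpan hn hmn hE r]
    exact genWeight_le (initialSpan_le x _) (finrank_initialSpan h.linearIndependent r.2).ge
  · obtain ⟨U, hU, hr, hw⟩ := exists_wt_eq_genWeight (C := Submodule.span F (Set.range x))
      (r := r + 1) (by rw [finrank_span_eq_card h.linearIndependent, Fintype.card_fin]; exact r.2)
    exact hw ▸ h.le_wt hn hmn hE r hU hr

theorem IsAdapted.genWeights_eq (hn : ∀ i, 0 < n i) (hmn : ∀ i, n i ≤ m i)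
    (hE : IsMaximalChain d E) (h : IsAdapted d E g x) :
    genWeights (Submodule.span F (Set.range x)) = List.ofFn g := by
  have hk : Module.finrank F (Submodule.span F (Set.range x)) = k := by
    rw [finrank_span_eq_card h.linearIndependent, Fintype.card_fin]
  refine List.ext_getElem (by simp [genWeights, hk]) fun s h1 h2 => ?_
  simp only [genWeights, List.getElem_ofFn]
  exact h.genWeight_eq hn hmn hE ⟨s, by simpa using h2⟩

theorem IsAdapted.wt_initialSpan_eq_genWeight (hn : ∀ i, 0 < n i) (hmn : ∀ i, n i ≤ m i)
    (hE : IsMaximalChain d E) (h : IsAdapted d E g x) (r : ℕ) (h1 : 1 ≤ r) (hr : r ≤ k) :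
    wt (initialSpan x r) = genWeight (Submodule.span F (Set.range x)) r := by
  obtain ⟨q, rfl⟩ := Nat.exists_eq_add_of_le' h1
  exact (h.wt_initialSpan hn hmn hE ⟨q, hr⟩).trans (h.genWeight_eq hn hmn hE ⟨q, hr⟩).symm

theorem IsAdapted.chainCondition (hn : ∀ i, 0 < n i) (hmn : ∀ i, n i ≤ m i)
    (hE : IsMaximalChain d E) (h : IsAdapted d E g x) :
    ChainCondition (Submodule.span F (Set.range x)) := by
  have hk : Module.finrank F (Submodule.span F (Set.range x)) = k := by
    rw [finrank_span_eq_card h.linearIndependent, Fintype.card_fin]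
  refine ⟨initialSpan x, by simp [initialSpan], by rw [hk, initialSpan_card], ?_, ?_⟩
  · rw [hk]
    intro r hr
    refine lt_of_le_of_ne (initialSpan_mono x (Nat.le_succ r)) fun heq => ?_
    have h1 := finrank_initialSpan h.linearIndependent hr.le
    rw [heq, finrank_initialSpan h.linearIndependent hr] at h1
    omega
  · rw [hk]
    exact fun r h1 hr => (h.wt_initialSpan_eq_genWeight hn hmn hE r h1 hr).symm

theorem IsAdapted.greedyWeights_eq (hn : ∀ i, 0 < n i) (hmn : ∀ i, n i ≤ m i)
    (hE : IsMaximalChain d E) (h : IsAdapted d E g x) :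
    greedyWeights (Submodule.span F (Set.range x)) = List.ofFn g := by
  have hk : Module.finrank F (Submodule.span F (Set.range x)) = k := by
    rw [finrank_span_eq_card h.linearIndependent, Fintype.card_fin]
  refine List.ext_getElem (by simp [greedyWeights, hk]) fun s h1 h2 => ?_
  have hs : s < k := by simpa using h2
  have hgreedy := isGreedySubcode_of_chain (initialSpan x) (k := k)
    (fun r _ => initialSpan_le x r) (fun r _ => initialSpan_mono x (Nat.le_succ r))
    (fun r hr => finrank_initialSpan h.linearIndependent hr)
    (h.wt_initialSpan_eq_genWeight hn hmn hE) (s + 1) (by omega) hs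
  simp only [greedyWeights, List.getElem_ofFn]
  rw [← hgreedy.wt_eq_greedyWeight]
  exact h.wt_initialSpan hn hmn hE ⟨s, hs⟩

end Adapted

/-- A chain of MSRD codes, continued by zero, is a maximal chain. -/
theorem isMaximalChain_of_isMSRD {d : ℕ} (hd : 0 < d) (E : ℕ → Code F m n)
    (hchain : ∀ h, d ≤ h → h < ∑ i, n i → E (h + 1) ≤ E h)
    (hMSRD : ∀ h, d ≤ h → h ≤ ∑ i, n i → IsMSRD (E h) ∧ minDist (E h) = h) :
    IsMaximalChain d fun h => if h ≤ ∑ i, n i then E h else ⊥ where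
  pos := hd
  anti h h' hdh hh := by
    induction h', hh using Nat.le_induction with
    | base => exact le_rfl
    | succ q hq ih =>
      refine le_trans ?_ ih
      by_cases hqn : q + 1 ≤ ∑ i, n i
      · simp only [if_pos hqn, if_pos (by omega : q ≤ ∑ i, n i)]
        exact hchain q (by omega) (by omega)
      · simp only [if_neg hqn]
        exact bot_le
  le_srk h hdh X hX hne := by
    by_cases hhn : h ≤ ∑ i, n i
    · simp only [if_pos hhn] at hX
      exact (hMSRD h hdh hhn).2 ▸ minDist_le_srk hX hne
    · simp only [if_neg hhn, Submodule.mem_bot] at hX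
      exact absurd hX hne
  finrank_add h hdh hh := by
    by_cases hhn : h ≤ ∑ i, n i
    · have h1 := (hMSRD h hdh hhn).1.finrank_add_prefixDim
      rw [(hMSRD h hdh hhn).2] at h1
      change Module.finrank F (if h ≤ ∑ i, n i then E h else ⊥ : Code F m n) + _ = _
      rwa [if_pos hhn]
    · have : h = ∑ i, n i + 1 := by omega
      subst this
      simp [prefixDim_sum]

end Chains

end SumRank

/-! ### The theorem -/

theorem theorem4p6 {F : Type*} [Field F] [Finite F] {t : ℕ} (m n : Fin t → ℕ)
    (hn : ∀ i, 0 < n i) (hm : Antitone m) (hmn : ∀ i, n i ≤ m i)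
    (D : SumRank.Code F m n) (hD : SumRank.IsMSRD D)
    (d : ℕ) (hd : SumRank.minDist D = d)
    -- the chain `D = E d ⊇ E (d + 1) ⊇ ⋯ ⊇ E (n₁ + ⋯ + n_t)` of MSRD codes
    (E : ℕ → SumRank.Code F m n) (hE : E d = D)
    (hchain : ∀ h, d ≤ h → h < ∑ i, n i → E (h + 1) ≤ E h)
    (hMSRD : ∀ h, d ≤ h → h ≤ ∑ i, n i →
      SumRank.IsMSRD (E h) ∧ SumRank.minDist (E h) = h) :
    (∀ l : List ℕ, (∀ x ∈ l, 0 < x) →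
      ((∃ C : SumRank.Code F m n, C ≤ D ∧ SumRank.genWeights C = l) ↔
        l.length ≤ Module.finrank F D ∧ List.Sublist l (SumRank.genWeights D))) ∧
    (∀ l : List ℕ, List.Sublist l (SumRank.genWeights D) →
      ∃ C : SumRank.Code F m n, C ≤ D ∧ SumRank.genWeights C = l ∧
        SumRank.ChainCondition C ∧ SumRank.greedyWeights C = l) := by
  open SumRank in
  have hd0 : 0 < d := hd ▸ hD.minDist_pos
  have hdn : d ≤ ∑ i, n i := hd ▸ hD.minDist_le
  have hC := isMaximalChain_of_isMSRD hd0 E hchain hMSRD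
  set E' : ℕ → Code F m n := fun h => if h ≤ ∑ i, n i then E h else ⊥ with hE'
  have hE'd : E' d = D := (if_pos hdn).trans hE
  obtain ⟨g, x, hgx, hcount⟩ := hC.exists_isAdapted le_rfl (by omega)
  have hspan_le : Submodule.span F (Set.range x) ≤ D := by
    refine Submodule.span_le.2 ?_
    rintro _ ⟨s, rfl⟩
    exact hE'd ▸ hC.anti _ _ le_rfl (hgx.ge s) (hgx.mem s)
  have hspan : Submodule.span F (Set.range x) = D :=
    Submodule.eq_of_le_of_finrank_le hspan_le (by
      rw [finrank_span_eq_card hgx.linearIndependent, Fintype.card_fin, hE'd])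
  have hgD : genWeights D = List.ofFn g := hspan ▸ hgx.genWeights_eq hn hmn hC
  have hexists : ∀ l : List ℕ, List.Sublist l (genWeights D) →
      ∃ C : Code F m n, C ≤ D ∧ genWeights C = l ∧ ChainCondition C ∧ greedyWeights C = l := by
    intro l hl
    rw [hgD] at hl
    obtain ⟨e, he⟩ := List.sublist_iff_exists_fin_orderEmbedding_get_eq.1 hl
    -- The positions of the sublist select a subfamily of the adapted basis, which is again adapted.
    let e' : Fin l.length ↪o Fin (Module.finrank F (E' d)) :=
      e.trans (Fin.castOrderIso (List.length_ofFn (f := g))).toOrderEmbedding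
    have hadapt := hgx.comp e'
    have hl' : List.ofFn (g ∘ e') = l := by
      refine List.ext_get (by simp) fun s h1 h2 => ?_
      rw [he ⟨s, h2⟩]
      simp [e']
      rfl
    refine ⟨Submodule.span F (Set.range (x ∘ e')), ?_, ?_, hadapt.chainCondition hn hmn hC, ?_⟩
    · exact (Submodule.span_mono (Set.range_comp_subset_range _ _)).trans hspan_le
    · exact (hadapt.genWeights_eq hn hmn hC).trans hl'
    · exact (hadapt.greedyWeights_eq hn hmn hC).trans hl'
  refine ⟨fun l _ => ⟨?_, ?_⟩, hexists⟩
  · rintro ⟨C, hCD, rfl⟩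
    refine ⟨by simpa [genWeights] using Submodule.finrank_mono hCD, ?_⟩
    -- Both lists are sorted, so comparing multiplicities suffices. Every weight of `C` lies between
    -- `d` and the number of columns, where `D` attains the maximal multiplicity.
    refine List.sublist_of_subperm_of_sortedLE (List.subperm_ext_iff.2 fun w hw => ?_) ?_ ?_
    · obtain ⟨s, rfl⟩ := List.mem_ofFn.1 hw
      obtain ⟨U, hUC, hU, hUw⟩ := exists_wt_eq_genWeight (C := C) (r := s + 1) s.2
      have hge : d ≤ genWeight C (s + 1) := by
        obtain ⟨X, hX, hX0⟩ : ∃ X ∈ U, X ≠ 0 := by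
          refine Submodule.exists_mem_ne_zero_of_ne_bot fun hbot => ?_
          rw [hbot, finrank_bot] at hU
          omega
        have h1 := minDist_le_srk (hCD (hUC hX)) hX0
        have h2 := srk_le_wt hn hmn hX
        omega
      have hle : genWeight C (s + 1) ≤ ∑ i, n i := hUw ▸ wt_le_sum hn hmn U
      rw [hgD, hcount _ hge hle]
      exact count_genWeights_le hn hm hmn C (by omega)
    · refine Monotone.sortedLE_ofFn fun r s hrs => ?_
      exact genWeight_mono C (Nat.succ_le_succ hrs) s.2
    · rw [hgD]
      exact hgx.mono.sortedLE_ofFn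
  · rintro ⟨-, hl⟩
    obtain ⟨C, hCD, hCl, -⟩ := hexists l hl
    exact ⟨C, hCD, hCl⟩
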